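/- Let $b$ be a prime, let $u_1\ge u_2\ge\cdots>0$ be real weights, and let $r>0$ be such that $\liminf_{j\to\infty}\log(u_j^{-1})/j^r>0$. Put $m_b=2\sin(\pi/b)$, $M_b=2$ if $b$ is even and $M_b=2\sin\frac{(b+1)\pi}{2b}$ if $b$ is odd, $C_2=2$ and $C_b=M_b+\frac{b\,m_b}{b-M_b}$ for $b\ne2$, and $a_j=-\log_b(C_bm_b^{-1}u_j)$. **Function space.** For $s\ge1$, $F_{s,u}$ is the space of $f\in C^\infty([0,1]^s)$ with $$\|f\|_{F_{s,u}}=\sup_{\alpha\in\mathbb N_0^s}\frac{\|f^{(\alpha_1,\dots,\alpha_s)}\|_{L^1}}{\prod_{j=1}^su_j^{\alpha_j}}<\infty .$$ For points $y_0,\dots,y_{N-1}\in[0,1]^s$ the worst-case error is $e^{\mathrm{wor}}(F_{s,u};P)=\sup_{\|f\|_{F_{s,u}}\le1}\bigl|\frac1N\sum_{n<N}f(y_n)-\int_{[0,1]^s}f\bigr|$. **Points.** Let $m,s,d\ge1$, let $p\in\mathbb Z_b[x]$ be irreducible of degree $m$, and let $q_1,q_2,\dots\in\mathbb Z_b[x]$.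 For $0\le n<b^m$ with $b$-adic digits $\kappa_i$ let $n(x)=\sum_i\kappa_ix^i$, and let $x_{n,t}=v_m(n(x)q_t(x)/p(x))$, where $v_m(\sum_lt_lx^{-l})=\sum_{l=1}^mt_lb^{-l}$ on $\mathbb Z_b((x^{-1}))$. Let $\xi_{i,n,t}$ be the $i$-th $b$-adic digit of $x_{n,t}\in[0,1)$. For $q=(q_1,\dots,q_{ds})$ the interlaced polynomial lattice point set $\mathcal D_d(P(q,p))$ consists of the $b^m$ points $y_n\in[0,1)^s$ (counted with multiplicity) with $j$-th coordinate $y_{n,j}=\sum_{i\ge1}\sum_{h=1}^d\xi_{i,n,d(j-1)+h}\,b^{-d(i-1)-h}$. **Algorithm.** Let $\eta(0)=b-1$ and $\eta(\xi)=-1$ for $\xi\ne0$. For $1\le\tau\le ds$ let $$B_u((q_1,\dots,q_\tau),p)=-1+\frac1{b^m}\sum_{n=0}^{b^m-1}\ \prod_{\substack{j\ge1,\ 1\le h\le d\\ d(j-1)+h\le\tau}}\ \prod_{i=1}^m\Bigl(1+\frac{\eta(\xi_{i,n,d(j-1)+h})}{b^{d(i-1)+h+a_j}}\Bigr).$$ The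 vector $q=(q_1,\dots,q_{ds})$ is *CBC-constructed* for $p$ if $q_1=1$ and, for each $\tau=2,\dots,ds$, $q_\tau$ minimizes $B_u((q_1,\dots,q_{\tau-1},\cdot),p)$ over the non-zero polynomials of degree less than $m$. **Claim.** For every $\lambda$ with $\frac{r+1}{2r+1}<\lambda\le1$ there are constants $D,E,E'>0$, depending only on $b$, the weight sequence $u$, $r$ and $\lambda$ (so not on $s$, and also not on $m,d,p,q$), such that for all $m,s,d\ge1$, all irreducible $p\in\mathbb Z_b[x]$ of degree $m$ and all CBC-constructed $q$, $$B_u(q,p)\le E\,b^{-\left(\log_b\frac{b^m-1}{D}\right)^{1/\lambda}},$$ and, if moreover $d\ge m^{r/(r+1)}$, $$e^{\mathrm{wor}}(F_{s,u};\mathcal D_d(P(q,p)))\le E'\,b^{-\left(\log_b\frac{b^m-1}{D+1}\right)^{1/\lambda}}.$$ Here a logarithm that is negative (which happens only when $b^m-1<D$, respectively $b^m-1<D+1$) is read as $0$, so that the powers are defined. -/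

import Mathlib

open scoped ContDiff ENNReal
open Polynomial

noncomputable section

namespace InterlacedLattice

/-! ### Constants and the exponents attached to the weights

Sequences indexed by the positive integers are indexed from `0` here: `u j` stands for the weight
with index `j + 1`. -/

/-- `m_b = min_{1 ≤ c < b} |1 - ω_b^{-c}| = 2 sin (π / b)`. -/
def minConst (b : ℕ) : ℝ := 2 * Real.sin (Real.pi / b)

/-- `M_b = max_{1 ≤ c < b} |1 - ω_b^{-c}|`. -/
def maxConst (b : ℕ) : ℝ :=
  if Even b then 2 else 2 * Real.sin ((b + 1) * Real.pi / (2 * b))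

/-- `C_b`. -/
def walshConst (b : ℕ) : ℝ :=
  if b = 2 then 2 else maxConst b + b * minConst b / (b - maxConst b)

/-- `a_j = - log_b (C_b m_b⁻¹ u_j)`. -/
def expo (b : ℕ) (u : ℕ → ℝ) (j : ℕ) : ℝ :=
  -Real.logb b (walshConst b * (minConst b)⁻¹ * u j)

/-! ### The weighted space of smooth functions and the worst-case error -/

/-- The closed unit cube `[0,1]^s`. -/
def cube (s : ℕ) : Set (Fin s → ℝ) := Set.Icc 0 1

/-- The partial derivative in the `j`-th coordinate on the closed cube (one-sided on its faces). -/
def partialDeriv {s : ℕ} (j : Fin s) (f : (Fin s → ℝ) → ℝ) : (Fin s → ℝ) → ℝ :=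
  fun x => fderivWithin ℝ f (cube s) x (Pi.single j 1)

/-- The mixed partial derivative `(∂/∂x_1)^{α_1} ⋯ (∂/∂x_s)^{α_s} f`. -/
def mixedDeriv {s : ℕ} (α : Fin s → ℕ) (f : (Fin s → ℝ) → ℝ) : (Fin s → ℝ) → ℝ :=
  (List.finRange s).foldr (fun j g => (partialDeriv j)^[α j] g) f

/-- `‖f‖ = sup_α ‖f^{(α)}‖_{L¹([0,1]^s)} / ∏_j u_j^{α_j}`, with values in `[0, ∞]`. -/
def weightedNorm (u : ℕ → ℝ) {s : ℕ} (f : (Fin s → ℝ) → ℝ) : ℝ≥0∞ :=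
  ⨆ α : Fin s → ℕ,
    (∫⁻ x in cube s, ‖mixedDeriv α f x‖ₑ) / ENNReal.ofReal (∏ j : Fin s, u j ^ α j)

/-- The weighted space `F_{s,u}` of smooth functions on `[0,1]^s`. -/
def weightedSpace (u : ℕ → ℝ) (s : ℕ) : Set ((Fin s → ℝ) → ℝ) :=
  {f | ContDiffOn ℝ ∞ f (cube s) ∧ weightedNorm u f < ⊤}

/-- The quasi-Monte Carlo rule with the points `y_0, …, y_{N-1}` (with multiplicity). -/
def qmc {s : ℕ} (N : ℕ) (y : ℕ → Fin s → ℝ) (f : (Fin s → ℝ) → ℝ) : ℝ :=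
  (∑ n ∈ Finset.range N, f (y n)) / N

/-- The worst-case error in the unit ball of `F_{s,u}` of the quasi-Monte Carlo rule with the
points `y_0, …, y_{N-1}`. -/
def worstCaseError (u : ℕ → ℝ) {s : ℕ} (N : ℕ) (y : ℕ → Fin s → ℝ) : ℝ≥0∞ :=
  ⨆ f ∈ {f ∈ weightedSpace u s | weightedNorm u f ≤ 1},
    ENNReal.ofReal |qmc N y f - ∫ x in cube s, f x|

/-! ### Interlaced polynomial lattice point sets -/

/-- The polynomial `k(x) = κ_0 + κ_1 x + ⋯` over `ℤ/b` whose coefficients are the `b`-adic digits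
of the integer `k`. -/
def digitPoly (b k : ℕ) : (ZMod b)[X] :=
  ∑ i ∈ Finset.range (Nat.digits b k).length, C (((Nat.digits b k).getD i 0 : ℕ) : ZMod b) * X ^ i

/-- The embedding of polynomials into the field of formal Laurent series in `x⁻¹`. The latter are
represented by Hahn series with exponents in `ℤ`, with the coefficient at `l` being the coefficient
of `x^{-l}`; so the polynomial variable goes to `single (-1) 1`. -/
def laurentEmbed (b : ℕ) (q : (ZMod b)[X]) : HahnSeries ℤ (ZMod b) :=
  Polynomial.aeval (HahnSeries.single (-1 : ℤ) (1 : ZMod b)) q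

/-- `v_m (∑_l t_l x^{-l}) = ∑_{l=1}^m t_l b^{-l}`. -/
def truncEval (b m : ℕ) (L : HahnSeries ℤ (ZMod b)) : ℝ :=
  ∑ l ∈ Finset.Icc 1 m, ((L.coeff (l : ℤ)).val : ℝ) / (b : ℝ) ^ l

/-- The point `x_n` of the polynomial lattice with generating vector `q` and modulus `p`. -/
def latticePoint (b m : ℕ) [Fact b.Prime] {t : ℕ} (q : Fin t → (ZMod b)[X]) (p : (ZMod b)[X])
    (n : ℕ) : Fin t → ℝ :=
  fun j => truncEval b m (laurentEmbed b (digitPoly b n) * laurentEmbed b (q j) / laurentEmbed b p)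

/-- The digit interlacing function `[0,1)^d → [0,1)`. Here `Real.digits x b i` is the digit of `x`
at `b^{-(i+1)}`, in the expansion that does not end in digits `b - 1`. -/
def interlace (b d : ℕ) [NeZero b] (x : Fin d → ℝ) : ℝ :=
  ∑' i : ℕ, ∑ j : Fin d, ((Real.digits (x j) b i : ℕ) : ℝ) / (b : ℝ) ^ (d * i + ((j : ℕ) + 1))

/-- The point `y_n` of the interlaced polynomial lattice of order `d`: the digit interlacing
function applied to consecutive blocks of `d` components of `x_n`.
`finProdFinEquiv (j, h)` is the index `d * j + h`. -/
def interlacedPoint (b m s d : ℕ) [Fact b.Prime] (q : Fin (s * d) → (ZMod b)[X])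
    (p : (ZMod b)[X]) (n : ℕ) : Fin s → ℝ :=
  fun j => interlace b d fun h => latticePoint b m q p n (finProdFinEquiv (j, h))

/-! ### The quality criterion and the component-by-component algorithm -/

/-- `η(0) = b - 1` and `η(ξ) = -1` for `ξ ≠ 0`. -/
def eta (b : ℕ) [NeZero b] (ξ : Fin b) : ℝ := if ξ = 0 then (b : ℝ) - 1 else -1

/-- The criterion `B_u(q_τ, p)` for a vector `q_τ` of `τ` polynomials and interlacing factor `d`.
The component with (zero-based) index `t` belongs to the block with index `t / d` and has position
`t % d + 1` in it; the digit index `i` is zero-based. -/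
def merit (b m d : ℕ) [Fact b.Prime] (u : ℕ → ℝ) {τ : ℕ} (q : Fin τ → (ZMod b)[X])
    (p : (ZMod b)[X]) : ℝ :=
  -1 + (∑ n ∈ Finset.range (b ^ m), ∏ t : Fin τ, ∏ i ∈ Finset.range m,
    (1 + eta b (Real.digits (latticePoint b m q p n t) b i) /
      (b : ℝ) ^ (((d * i + ((t : ℕ) % d + 1) : ℕ) : ℝ) + expo b u ((t : ℕ) / d)))) / (b : ℝ) ^ m

/-- The set `R_{b,m}` of non-zero polynomials of degree less than `m`. -/
def candidates (b m : ℕ) : Set (ZMod b)[X] := {q | q ≠ 0 ∧ q.degree < m}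

/-- `q` is a possible output of the component-by-component algorithm with modulus `p`: the first
component is `1`, and each later component minimizes the criterion over `R_{b,m}`, the preceding
components being kept fixed. -/
def IsCBC (b m s d : ℕ) [Fact b.Prime] (u : ℕ → ℝ) (p : (ZMod b)[X])
    (q : Fin (s * d) → (ZMod b)[X]) : Prop :=
  (∀ h : 0 < s * d, q ⟨0, h⟩ = 1) ∧
  ∀ τ : ℕ, 0 < τ → ∀ h : τ < s * d,
    q ⟨τ, h⟩ ∈ candidates b m ∧
    ∀ q' ∈ candidates b m,
      merit b m d u (fun t : Fin (τ + 1) => q (Fin.castLE h t)) p ≤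
        merit b m d u
          (Fin.snoc (α := fun _ => (ZMod b)[X]) (fun t : Fin τ => q (Fin.castLE h.le t)) q') p

/-- The rate `b^{-(log_b ((b^m - 1) / D))^{1/λ}}`. The logarithm is replaced by `0` when it is
negative, that is when `b^m - 1 < D`, where the power would not be defined. -/
def rate (b m : ℕ) (lam D : ℝ) : ℝ :=
  (b : ℝ) ^ (-(max 0 (Real.logb b (((b : ℝ) ^ m - 1) / D))) ^ (1 / lam))

end InterlacedLattice

end

open InterlacedLattice

noncomputable section

namespace InterlacedLattice

/-! ### Digits of finite `b`-adic expansions -/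

/-! Expanding the product in the criterion into additive characters of `ZMod b` and averaging over
the lattice points leaves only the digit vectors `k` of the dual lattice. Hence `merit` is the sum
over nonzero dual `k` of a product of weights, one for each nonzero digit (`merit_eq_sum`).

The best new component is at most the average over all candidates. Subadditivity of the power `l`,
for any `0 < l ≤ 1`, and the fact that a nonzero `κ` is invertible modulo the irreducible `p` give
`(b^m - 1) * merit^l ≤ ∏ (1 + (b - 1) w^l)` (`IsCBC.merit_rpow_le`). The weights decay so fast that
`∑ w^l = O(l^{-(1+e)})` for every `e > 1/r`, uniformly in `s` and `d`
(`exists_sum_digitWeight_rpow_le`). The exponent `l` is free, and `l = m^{-σ}` with `σ` just below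
`r/(r+1)` gives `merit = O(b^{-2 m^{1/λ}})` (`exists_merit_le`), twice the exponent that the claim
needs.

For the error, each nonzero digit of a Walsh function permits one integration by parts, which puts a
derivative on `f` and gains a power of `b`. So the Walsh coefficients are bounded by products of the
same weights, up to a constant `K` per digit (`norm_walshCoeff_le`). The error of the rule is the
sum of the coefficients over the dual lattice, now with digits of every length
(`abs_qmc_sub_integral_le`). Writing `K w` as `w^{1/2}` times `K w^{1/2}`, the first factor is
controlled by the square root of `merit + X b^{-dm}` and the second is summable over all `k`
(`sum_isDual_le`). The square root uses up the spare factor 2, and `d ≥ m^{r/(r+1)}` makes `b^{-dm}`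
small enough. -/

theorem ofDigits_lt_one {b : ℕ} (M : ℕ) (a : ℕ → Fin b) (ha : ∀ l, M ≤ l → (a l : ℕ) = 0) :
    Real.ofDigits a < 1 := by
  have hb : 0 < b := Fin.pos (a 0)
  have hb' : (0 : ℝ) < b := by exact_mod_cast hb
  induction M generalizing a with
  | zero =>
    have : Real.ofDigits a = 0 := by
      simp [Real.ofDigits, Real.ofDigitsTerm, ha]
    rw [this]; exact one_pos
  | succ M ih =>
    have h := Real.ofDigits_eq_sum_add_ofDigits a 1
    have h2 := ih (fun i => a (i + 1)) (fun l hl => ha (l + 1) (by omega))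
    simp only [Finset.range_one, Finset.sum_singleton, Real.ofDigitsTerm, zero_add, pow_one] at h
    rw [h]
    have h3 : ((a 0 : ℕ) : ℝ) + 1 ≤ b := by exact_mod_cast (a 0).isLt
    calc ((a 0 : ℕ) : ℝ) * (b : ℝ)⁻¹ + (b : ℝ)⁻¹ * Real.ofDigits (fun i => a (i + 1))
        < ((a 0 : ℕ) : ℝ) * (b : ℝ)⁻¹ + (b : ℝ)⁻¹ * 1 := by gcongr
      _ = (((a 0 : ℕ) : ℝ) + 1) * (b : ℝ)⁻¹ := by ring
      _ ≤ b * (b : ℝ)⁻¹ := by gcongr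
      _ = 1 := mul_inv_cancel₀ hb'.ne'

/-- The tail after `i + 1` digits is less than 1, so the floor of `b^(i+1) x` is the integer formed
by the first `i + 1` digits, and reduction modulo `b` leaves the last of them. -/
theorem digits_ofDigits {b : ℕ} [NeZero b] (M : ℕ) (a : ℕ → Fin b)
    (ha : ∀ l, M ≤ l → (a l : ℕ) = 0) : Real.digits (Real.ofDigits a) b = a := by
  have hb' : (b : ℝ) ≠ 0 := NeZero.ne _
  funext i
  have h := Real.ofDigits_eq_sum_add_ofDigits a (i + 1)
  have h1 := ofDigits_lt_one M (fun l => a (l + (i + 1))) (fun l hl => ha _ (by omega))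
  have h0 := Real.ofDigits_nonneg (fun l => a (l + (i + 1)))
  have key : Real.ofDigits a * b ^ (i + 1) =
      ((∑ l ∈ Finset.range i, (a l : ℕ) * b ^ (i - l) + (a i : ℕ) : ℕ) : ℝ) +
        Real.ofDigits (fun l => a (l + (i + 1))) := by
    rw [h, add_mul]
    congr 1
    · rw [Finset.sum_mul, Finset.sum_range_succ]
      push_cast
      congr 1
      · refine Finset.sum_congr rfl fun l hl => ?_
        have hl' := Finset.mem_range.1 hl
        rw [Real.ofDigitsTerm, mul_assoc]
        congr 1
        rw [show i + 1 = (l + 1) + (i - l) by omega, pow_add (b : ℝ) (l + 1) (i - l),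
          inv_mul_cancel_left₀ (pow_ne_zero _ hb')]
      · rw [Real.ofDigitsTerm]; field_simp
    · field_simp
  have hf : ⌊Real.ofDigits a * b ^ (i + 1)⌋₊ =
      ∑ l ∈ Finset.range i, (a l : ℕ) * b ^ (i - l) + (a i : ℕ) := by
    rw [key, add_comm, Nat.floor_add_natCast h0, Nat.floor_eq_zero.2 h1, zero_add]
  apply Fin.ext
  have hd : b ∣ ∑ l ∈ Finset.range i, (a l : ℕ) * b ^ (i - l) := by
    refine Finset.dvd_sum fun l hl => ?_
    have hl' := Finset.mem_range.1 hl
    exact Dvd.dvd.mul_left (dvd_pow_self b (by omega)) _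
  rw [Real.digits, hf, Fin.val_ofNat, Nat.add_mod, Nat.mod_eq_zero_of_dvd hd, zero_add,
    Nat.mod_mod, Nat.mod_eq_of_lt (a i).isLt]

/-! ### Laurent coefficients of rational functions -/

theorem hahnSeries_algebraMap (b : ℕ) (a : ZMod b) :
    algebraMap (ZMod b) (HahnSeries ℤ (ZMod b)) a = HahnSeries.single 0 a := by
  rw [HahnSeries.algebraMap_apply', ← HahnSeries.C_apply, ← HahnSeries.ofPowerSeries_C]
  rfl

theorem laurentEmbed_coeff (b : ℕ) (g : (ZMod b)[X]) (n : ℤ) :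
    (laurentEmbed b g).coeff n = if n ≤ 0 then g.coeff (-n).toNat else 0 := by
  induction g using Polynomial.induction_on' with
  | add f g hf hg =>
    simp only [laurentEmbed, map_add, HahnSeries.coeff_add] at hf hg ⊢
    rw [hf, hg]; split_ifs <;> simp
  | monomial i a =>
    rw [laurentEmbed, Polynomial.aeval_monomial, HahnSeries.single_pow, Polynomial.coeff_monomial,
      one_pow]
    rw [hahnSeries_algebraMap, HahnSeries.single_mul_single, mul_one, zero_add, HahnSeries.coeff_single]
    simp only [nsmul_eq_mul, mul_neg, mul_one]
    split_ifs <;> first | rfl | omega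

variable {b : ℕ} [hbp : Fact b.Prime]

/-- The coefficient of `x^{-(i+1)}` in the Laurent expansion of `g / p`. -/
def quotCoeff (p g : (ZMod b)[X]) (i : ℕ) : ZMod b :=
  (laurentEmbed b g / laurentEmbed b p).coeff ((i : ℤ) + 1)

theorem laurentEmbed_ne_zero {g : (ZMod b)[X]} (hg : g ≠ 0) : laurentEmbed b g ≠ 0 := by
  intro h
  apply hg
  ext n
  have := laurentEmbed_coeff b g (-(n : ℤ))
  simpa [h] using this.symm

theorem quotCoeff_add (p g h : (ZMod b)[X]) (i : ℕ) :
    quotCoeff p (g + h) i = quotCoeff p g i + quotCoeff p h i := by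
  simp [quotCoeff, laurentEmbed, add_div]

/-- `quotCoeff p · i` as an additive homomorphism. -/
def quotCoeffHom (p : (ZMod b)[X]) (i : ℕ) : (ZMod b)[X] →+ ZMod b where
  toFun g := quotCoeff p g i
  map_zero' := by simp [quotCoeff, laurentEmbed]
  map_add' g h := quotCoeff_add p g h i

theorem quotCoeff_C_mul_X_pow_mul (p g : (ZMod b)[X]) (a : ZMod b) (l i : ℕ) :
    quotCoeff p (C a * X ^ l * g) i = a * quotCoeff p g (i + l) := by
  have : laurentEmbed b (C a * X ^ l * g) / laurentEmbed b p =
      HahnSeries.single (-(l : ℤ)) a * (laurentEmbed b g / laurentEmbed b p) := by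
    rw [mul_div_assoc']
    congr 1
    simp only [laurentEmbed, map_mul, map_pow, aeval_X, aeval_C, HahnSeries.single_pow, one_pow]
    congr 1
    rw [hahnSeries_algebraMap, HahnSeries.single_mul_single]
    simp
  rw [quotCoeff, this, HahnSeries.coeff_single_mul, quotCoeff]
  congr 2
  push_cast; ring

theorem quotCoeff_of_dvd {p g : (ZMod b)[X]} (hp : p ≠ 0) (h : p ∣ g) (i : ℕ) :
    quotCoeff p g i = 0 := by
  obtain ⟨c, rfl⟩ := h
  have : laurentEmbed b (p * c) = laurentEmbed b p * laurentEmbed b c := by simp [laurentEmbed]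
  rw [quotCoeff, this, mul_div_cancel_left₀ _ (laurentEmbed_ne_zero hp), laurentEmbed_coeff,
    if_neg (by omega)]

theorem laurentEmbed_order {g : (ZMod b)[X]} (hg : g ≠ 0) :
    (laurentEmbed b g).order = -(g.natDegree : ℤ) := by
  apply le_antisymm
  · apply HahnSeries.order_le_of_coeff_ne_zero
    rw [laurentEmbed_coeff, if_pos (by omega)]
    simpa using hg
  · rw [HahnSeries.le_order_iff_forall (laurentEmbed_ne_zero hg)]
    intro j hj
    rw [laurentEmbed_coeff]
    split_ifs with h
    · exact Polynomial.coeff_eq_zero_of_natDegree_lt (by omega)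
    · rfl

/-- The order of `g / p` is the difference of the degrees, here 1, so this coefficient is the
leading one. -/
theorem quotCoeff_zero_ne_zero {p g : (ZMod b)[X]} (hp : p ≠ 0) (hg : g ≠ 0)
    (h : g.natDegree + 1 = p.natDegree) : quotCoeff p g 0 ≠ 0 := by
  have hp' := laurentEmbed_ne_zero hp
  have hg' := laurentEmbed_ne_zero hg
  have hq : laurentEmbed b g / laurentEmbed b p ≠ 0 := div_ne_zero hg' hp'
  have ho : (laurentEmbed b g / laurentEmbed b p).order = 1 := by
    have h1 := HahnSeries.order_mul hq hp'
    rw [div_mul_cancel₀ _ hp', laurentEmbed_order hg, laurentEmbed_order hp] at h1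
    omega
  have := HahnSeries.coeff_order_eq_zero.not.2 hq
  rw [ho] at this
  simpa [quotCoeff] using this

/-- Non-degeneracy of the residue pairing on polynomials modulo `p`. -/
theorem dvd_of_quotCoeff_eq_zero {p g : (ZMod b)[X]} (hp : p ≠ 0)
    (h : ∀ l < p.natDegree, quotCoeff p (X ^ l * g) 0 = 0) : p ∣ g := by
  by_contra hd
  set ρ := g % p with hρ
  have hρ0 : ρ ≠ 0 := fun h0 => hd (EuclideanDomain.mod_eq_zero.1 h0)
  have hdeg : ρ.degree < p.degree := EuclideanDomain.mod_lt g hp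
  have hnd : ρ.natDegree < p.natDegree := (Polynomial.natDegree_lt_natDegree_iff hρ0).2 hdeg
  -- This shift raises the remainder to degree exactly `p.natDegree - 1`, where the residue cannot
  -- vanish.
  set l := p.natDegree - 1 - ρ.natDegree with hl
  have h1 := h l (by omega)
  have h2 : X ^ l * g = X ^ l * ρ + p * (X ^ l * (g / p)) := by
    conv_lhs => rw [← EuclideanDomain.div_add_mod g p]
    ring
  rw [h2, quotCoeff_add, quotCoeff_of_dvd hp (Dvd.intro _ rfl), add_zero] at h1
  refine quotCoeff_zero_ne_zero hp (mul_ne_zero (pow_ne_zero _ X_ne_zero) hρ0) ?_ h1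
  rw [Polynomial.natDegree_mul (pow_ne_zero _ X_ne_zero) hρ0, natDegree_X_pow]
  omega

/-- The polynomial `∑_i κ_i x^i`. -/
def coeffPoly {m : ℕ} (κ : Fin m → ZMod b) : (ZMod b)[X] := ∑ i : Fin m, C (κ i) * X ^ (i : ℕ)

theorem coeffPoly_coeff {m : ℕ} (κ : Fin m → ZMod b) (i : Fin m) :
    (coeffPoly κ).coeff i = κ i := by
  simp [coeffPoly, Polynomial.finsetSum_coeff, Polynomial.coeff_X_pow, Fin.val_inj]

theorem coeffPoly_degree {m : ℕ} (κ : Fin m → ZMod b) : (coeffPoly κ).degree < m := by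
  unfold coeffPoly
  refine (Polynomial.degree_sum_le _ _).trans_lt ?_
  rw [Finset.sup_lt_iff (by exact WithBot.bot_lt_coe m)]
  intro i _
  exact (Polynomial.degree_C_mul_X_pow_le _ _).trans_lt (by exact_mod_cast i.isLt)

theorem coeffPoly_zero {m : ℕ} : coeffPoly (0 : Fin m → ZMod b) = 0 := by simp [coeffPoly]

theorem coeffPoly_sub {m : ℕ} (κ κ' : Fin m → ZMod b) :
    coeffPoly (κ - κ') = coeffPoly κ - coeffPoly κ' := by
  simp [coeffPoly, sub_mul, Finset.sum_sub_distrib]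

theorem coeffPoly_add {m : ℕ} (κ κ' : Fin m → ZMod b) :
    coeffPoly (κ + κ') = coeffPoly κ + coeffPoly κ' := by
  simp [coeffPoly, add_mul, Finset.sum_add_distrib]

theorem coeffPoly_eq_zero_iff {m : ℕ} (κ : Fin m → ZMod b) : coeffPoly κ = 0 ↔ κ = 0 := by
  refine ⟨fun h => ?_, fun h => by rw [h, coeffPoly_zero]⟩
  funext i
  rw [← coeffPoly_coeff κ i, h]; simp

/-- Multiplying by `x^i` shifts Laurent coefficients, so a pairing of digit vectors becomes one
residue, the coefficient of `x^{-1}`. -/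
theorem sum_mul_quotCoeff {m : ℕ} (p g : (ZMod b)[X]) (κ : Fin m → ZMod b) :
    ∑ i : Fin m, κ i * quotCoeff p g i = quotCoeff p (coeffPoly κ * g) 0 := by
  have : quotCoeff p (coeffPoly κ * g) 0 = quotCoeffHom p 0 (coeffPoly κ * g) := rfl
  rw [this, coeffPoly, Finset.sum_mul, map_sum]
  refine Finset.sum_congr rfl fun i _ => ?_
  change _ = quotCoeff p _ 0
  rw [quotCoeff_C_mul_X_pow_mul, zero_add]

/-! ### Digits of the lattice points -/

instance : NeZero b := ⟨hbp.out.ne_zero⟩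

theorem digitPoly_eq_coeffPoly {m : ℕ} (n : ℕ) (hn : n < b ^ m) :
    digitPoly b n = coeffPoly fun i : Fin m => ((n / b ^ (i : ℕ) % b : ℕ) : ZMod b) := by
  have hb := hbp.out.two_le
  ext l
  have h1 : (digitPoly b n).coeff l = ((n / b ^ l % b : ℕ) : ZMod b) := by
    rw [digitPoly, Polynomial.finsetSum_coeff]
    simp only [Polynomial.coeff_C_mul, Polynomial.coeff_X_pow, mul_ite, mul_one, mul_zero,
      Finset.sum_ite_eq, Finset.mem_range, ← Nat.getD_digits n l hb]
    split_ifs with h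
    · rfl
    · rw [List.getD_eq_default _ _ (by omega)]; simp
  rw [h1]
  by_cases hl : l < m
  · exact (coeffPoly_coeff (fun i : Fin m => ((n / b ^ (i : ℕ) % b : ℕ) : ZMod b)) ⟨l, hl⟩).symm
  · rw [Polynomial.coeff_eq_zero_of_degree_lt ((coeffPoly_degree _).trans_le
      (by exact_mod_cast not_lt.1 hl)), Nat.div_eq_of_lt (hn.trans_le (Nat.pow_le_pow_right
      hbp.out.pos (not_lt.1 hl)))]
    simp

/-- The digit of the `t`-th component of the `n`-th lattice point at `b^{-(i+1)}`. -/
def latticeDigit (m : ℕ) {τ : ℕ} (q : Fin τ → (ZMod b)[X]) (p : (ZMod b)[X]) (n : ℕ) (t : Fin τ)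
    (i : ℕ) : ZMod b :=
  if i < m then quotCoeff p (digitPoly b n * q t) i else 0

/-- The point is a finite `b`-adic sum with `m` digits, so `Real.digits` recovers exactly these
digits and then zeros. -/
theorem digits_latticePoint (m : ℕ) {τ : ℕ} (q : Fin τ → (ZMod b)[X]) (p : (ZMod b)[X]) (n : ℕ)
    (t : Fin τ) (i : ℕ) :
    (Real.digits (latticePoint b m q p n t) b i : ℕ) = (latticeDigit m q p n t i).val := by
  set a : ℕ → Fin b := fun l => ⟨(latticeDigit m q p n t l).val, ZMod.val_lt _⟩ with ha
  have ha0 : ∀ l, m ≤ l → (a l : ℕ) = 0 := fun l hl => by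
    simp [ha, latticeDigit, not_lt.2 hl]
  have h : latticePoint b m q p n t = Real.ofDigits a := by
    rw [Real.ofDigits_eq_sum_add_ofDigits a m]
    have h0 : Real.ofDigits (fun i => a (i + m)) = 0 := by
      simp [Real.ofDigits, Real.ofDigitsTerm, ha0]
    rw [h0, mul_zero, add_zero, latticePoint, truncEval, ← Finset.Ico_add_one_right_eq_Icc,
      Finset.sum_Ico_eq_sum_range, Nat.add_sub_cancel]
    refine Finset.sum_congr rfl fun l hl => ?_
    rw [Real.ofDigitsTerm, div_eq_mul_inv]
    simp only [ha, latticeDigit, if_pos (Finset.mem_range.1 hl), quotCoeff]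
    rw [add_comm 1 l]
    simp [laurentEmbed]
  rw [h, digits_ofDigits m a ha0]

end InterlacedLattice

namespace InterlacedLattice

variable {b : ℕ} [hbp : Fact b.Prime]

/-! ### Character sums over the lattice points -/

theorem digitVector_bijective (m : ℕ) : Function.Bijective
    fun (n : Fin (b ^ m)) (i : Fin m) => (((n : ℕ) / b ^ (i : ℕ) % b : ℕ) : ZMod b) := by
  rw [Fintype.bijective_iff_injective_and_card]
  refine ⟨fun n n' h => ?_, by simp [ZMod.card]⟩
  apply finFunctionFinEquiv.symm.injective
  funext i
  apply Fin.ext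
  have h1 := congrFun h i
  simp only [ZMod.natCast_eq_natCast_iff', Nat.mod_mod] at h1
  exact h1

theorem sum_range_digitPoly {M : Type*} [AddCommMonoid M] (m : ℕ) (Ψ : (ZMod b)[X] → M) :
    ∑ n ∈ Finset.range (b ^ m), Ψ (digitPoly b n) = ∑ a : Fin m → ZMod b, Ψ (coeffPoly a) := by
  rw [Finset.sum_range, ← (digitVector_bijective (b := b) m).sum_comp]
  refine Finset.sum_congr rfl fun n _ => ?_
  rw [digitPoly_eq_coeffPoly n n.isLt]

/-- The dual lattice: the digit vectors `k` with `∑_t k_t(x) q_t(x) ≡ 0` modulo `p`. -/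
def IsDual {τ m : ℕ} (p : (ZMod b)[X]) (q : Fin τ → (ZMod b)[X]) (k : Fin τ → Fin m → ZMod b) :
    Prop :=
  p ∣ ∑ t, coeffPoly (k t) * q t

theorem stdAddChar_eq_one_iff (x : ZMod b) : ZMod.stdAddChar x = 1 ↔ x = 0 := by
  refine ⟨fun h => ?_, fun h => by rw [h, AddChar.map_zero_eq_one]⟩
  exact ZMod.injective_stdAddChar (h.trans (AddChar.map_zero_eq_one _).symm)

theorem stdAddChar_sum {ι : Type*} (s : Finset ι) (f : ι → ZMod b) :
    (ZMod.stdAddChar (∑ i ∈ s, f i) : ℂ) = ∏ i ∈ s, ZMod.stdAddChar (f i) := by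
  classical
  induction s using Finset.induction_on with
  | empty => simp [AddChar.map_zero_eq_one]
  | insert a s ha ih => rw [Finset.sum_insert ha, Finset.prod_insert ha, AddChar.map_add_eq_mul, ih]

open scoped Classical in
-- The summand is an additive character of the group of digit vectors of `n`. It is trivial exactly
-- when all residues of `x^l * G / p` with `l < m` vanish, which by non-degeneracy means that `p`
-- divides `G`.
theorem sum_stdAddChar_quotCoeff {m τ : ℕ} {p : (ZMod b)[X]} (hp : p ≠ 0) (hm : p.natDegree = m)
    (q : Fin τ → (ZMod b)[X]) (k : Fin τ → Fin m → ZMod b) :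
    ∑ n ∈ Finset.range (b ^ m), ZMod.stdAddChar
      (∑ t, ∑ i : Fin m, k t i * quotCoeff p (digitPoly b n * q t) i) =
      if IsDual p q k then (b : ℂ) ^ m else 0 := by
  set G := ∑ t, coeffPoly (k t) * q t with hG
  let L : (Fin m → ZMod b) →+ ZMod b :=
    { toFun := fun a => quotCoeff p (coeffPoly a * G) 0
      map_zero' := by rw [coeffPoly_zero, zero_mul]; exact map_zero (quotCoeffHom p 0)
      map_add' := fun a a' => by rw [coeffPoly_add, add_mul, quotCoeff_add] }
  have h1 : ∀ g : (ZMod b)[X], ∑ t, ∑ i : Fin m, k t i * quotCoeff p (g * q t) i =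
      quotCoeff p (g * G) 0 := by
    intro g
    simp_rw [sum_mul_quotCoeff]
    change ∑ t, quotCoeffHom p 0 (coeffPoly (k t) * (g * q t)) = quotCoeffHom p 0 (g * G)
    rw [← map_sum, hG, Finset.mul_sum]
    congr 1
    exact Finset.sum_congr rfl fun t _ => by ring
  simp_rw [h1]
  rw [sum_range_digitPoly m (fun g => (ZMod.stdAddChar (quotCoeff p (g * G) 0) : ℂ))]
  have h2 := AddChar.sum_eq_ite (ZMod.stdAddChar.compAddMonoidHom L)
  have h3 : (ZMod.stdAddChar (N := b)).compAddMonoidHom L = 0 ↔ IsDual p q k := by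
    rw [AddChar.ext_iff]
    constructor
    · intro h
      apply dvd_of_quotCoeff_eq_zero hp
      intro l hl
      -- Evaluating the character at a unit vector tests the residue against `x^l`.
      have h4 := h (Pi.single ⟨l, hm ▸ hl⟩ 1)
      have h5 : coeffPoly (Pi.single (⟨l, hm ▸ hl⟩ : Fin m) (1 : ZMod b)) = X ^ l := by
        rw [coeffPoly, Finset.sum_eq_single ⟨l, hm ▸ hl⟩]
        · simp
        · intro i _ hi; simp [Pi.single_eq_of_ne hi]
        · simp
      rw [AddChar.compAddMonoidHom_apply, AddChar.zero_apply, stdAddChar_eq_one_iff] at h4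
      rw [← h5]; exact h4
    · intro h a
      rw [AddChar.compAddMonoidHom_apply, AddChar.zero_apply, stdAddChar_eq_one_iff]
      exact quotCoeff_of_dvd hp (Dvd.dvd.mul_left h _) 0
  simp only [h3] at h2
  refine h2.trans ?_
  simp [ZMod.card]

/-! ### The criterion as a sum over the dual lattice -/

/-- The product of the weights `w t i` over the support of `k`. -/
def supportWeight {τ m : ℕ} (w : Fin τ → Fin m → ℝ) (k : Fin τ → Fin m → ZMod b) : ℝ :=
  ∏ t, ∏ i, if k t i = 0 then 1 else w t i

theorem supportWeight_nonneg {τ m : ℕ} {w : Fin τ → Fin m → ℝ} (hw : ∀ t i, 0 ≤ w t i)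
    (k : Fin τ → Fin m → ZMod b) : 0 ≤ supportWeight w k :=
  Finset.prod_nonneg fun t _ => Finset.prod_nonneg fun i _ => by
    split_ifs <;> [exact zero_le_one; exact hw t i]

theorem sum_prod_prod {R : Type*} [CommSemiring R] {τ m : ℕ} (F : Fin τ → Fin m → ZMod b → R) :
    ∑ k : Fin τ → Fin m → ZMod b, ∏ t, ∏ i, F t i (k t i) = ∏ t, ∏ i, ∑ c, F t i c := by
  simp_rw [Finset.prod_univ_sum, Fintype.piFinset_univ]

theorem sum_supportWeight {τ m : ℕ} (w : Fin τ → Fin m → ℝ) :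
    ∑ k : Fin τ → Fin m → ZMod b, supportWeight w k = ∏ t, ∏ i, (1 + (b - 1) * w t i) := by
  unfold supportWeight
  rw [sum_prod_prod (fun t i c => if c = 0 then (1 : ℝ) else w t i)]
  refine Finset.prod_congr rfl fun t _ => Finset.prod_congr rfl fun i _ => ?_
  rw [Finset.sum_ite, Finset.sum_const, Finset.sum_const, Finset.filter_eq', Finset.filter_ne']
  have : 1 ≤ b := hbp.out.one_le
  simp [ZMod.card, Nat.cast_sub this]

theorem supportWeight_rpow {τ m : ℕ} {w : Fin τ → Fin m → ℝ} (hw : ∀ t i, 0 ≤ w t i) (lam : ℝ)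
    (k : Fin τ → Fin m → ZMod b) :
    supportWeight w k ^ lam = supportWeight (fun t i => w t i ^ lam) k := by
  unfold supportWeight
  have h1 : ∀ t i, 0 ≤ (if k t i = 0 then 1 else w t i) := fun t i => by
    split_ifs <;> [exact zero_le_one; exact hw t i]
  rw [← Real.finsetProd_rpow _ _ (fun t _ => Finset.prod_nonneg fun i _ => h1 t i)]
  refine Finset.prod_congr rfl fun t _ => ?_
  rw [← Real.finsetProd_rpow _ _ (fun i _ => h1 t i)]
  refine Finset.prod_congr rfl fun i _ => ?_
  split_ifs <;> simp

theorem supportWeight_zero {τ m : ℕ} (w : Fin τ → Fin m → ℝ) :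
    supportWeight w (0 : Fin τ → Fin m → ZMod b) = 1 := by
  simp [supportWeight]

/-- The weight `b^{-(d i + h + a_j)}` of the digit with zero-based index `i` of the component
with zero-based index `t`. -/
def digitWeight (b d : ℕ) (u : ℕ → ℝ) (t i : ℕ) : ℝ :=
  ((b : ℝ) ^ (((d * i + (t % d + 1) : ℕ) : ℝ) + expo b u (t / d)))⁻¹

theorem digitWeight_pos (d : ℕ) (u : ℕ → ℝ) (t i : ℕ) : 0 < digitWeight b d u t i := by
  have : (0 : ℝ) < b := by exact_mod_cast hbp.out.pos
  unfold digitWeight; positivity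

/-- `η` is the Fourier transform of the indicator of the nonzero residues: the full character sum is
`b` or 0, and the term `κ = 0` is corrected by `1 - w`. -/
theorem one_add_eta_mul (ξ : ZMod b) (ξ' : Fin b) (h : (ξ' : ℕ) = ξ.val) (w : ℝ) :
    ((1 + eta b ξ' * w : ℝ) : ℂ) =
      ∑ κ : ZMod b, ZMod.stdAddChar (κ * ξ) * ((if κ = 0 then 1 else w : ℝ) : ℂ) := by
  have h1 : ∀ κ : ZMod b, (ZMod.stdAddChar (κ * ξ) * ((if κ = 0 then 1 else w : ℝ) : ℂ) : ℂ) =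
      w * ZMod.stdAddChar (κ * ξ) + if κ = 0 then 1 - (w : ℂ) else 0 := by
    intro κ
    split_ifs with h0
    · simp [h0, AddChar.map_zero_eq_one]
    · rw [add_zero, mul_comm]
  simp_rw [h1]
  rw [Finset.sum_add_distrib, ← Finset.mul_sum, AddChar.sum_mulShift ξ (ZMod.isPrimitive_stdAddChar b)]
  rw [Finset.sum_ite_eq' Finset.univ (0 : ZMod b), if_pos (Finset.mem_univ _), ZMod.card]
  have h2 : ξ' = 0 ↔ ξ = 0 := by
    rw [← ZMod.val_eq_zero, ← h, ← Fin.val_eq_zero_iff]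
  unfold eta
  by_cases h0 : ξ = 0
  · rw [if_pos (h2.2 h0), if_pos h0]; push_cast; ring
  · rw [if_neg (fun h => h0 (h2.1 h)), if_neg h0]; push_cast; ring

open scoped Classical in
theorem merit_eq_sum {m d τ : ℕ} (u : ℕ → ℝ) {p : (ZMod b)[X]} (hp : p ≠ 0)
    (hm : p.natDegree = m) (q : Fin τ → (ZMod b)[X]) :
    1 + merit b m d u q p = ∑ k : Fin τ → Fin m → ZMod b,
      if IsDual p q k then supportWeight (fun t i => digitWeight b d u t i) k else 0 := by
  have hb : (b : ℂ) ≠ 0 := by exact_mod_cast hbp.out.ne_zero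
  apply Complex.ofReal_injective
  unfold merit
  rw [add_neg_cancel_left]
  simp only [Complex.ofReal_div, Complex.ofReal_sum, Complex.ofReal_prod, Complex.ofReal_add,
    Complex.ofReal_one, Complex.ofReal_pow, Complex.ofReal_natCast, apply_ite Complex.ofReal,
    Complex.ofReal_zero]
  have h1 : ∀ n, ∏ t : Fin τ, ∏ i ∈ Finset.range m,
      ((1 : ℂ) + (eta b (Real.digits (latticePoint b m q p n t) b i) : ℂ) /
        (((b : ℝ) ^ ((((d * i + ((t : ℕ) % d + 1) : ℕ) : ℝ)) + expo b u ((t : ℕ) / d)) : ℝ) : ℂ)) =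
      ∑ k : Fin τ → Fin m → ZMod b, ZMod.stdAddChar
        (∑ t, ∑ i : Fin m, k t i * quotCoeff p (digitPoly b n * q t) i) *
        (supportWeight (fun t i => digitWeight b d u t i) k : ℂ) := by
    intro n
    have h2 : ∀ k : Fin τ → Fin m → ZMod b, (ZMod.stdAddChar
        (∑ t, ∑ i : Fin m, k t i * quotCoeff p (digitPoly b n * q t) i) *
        (supportWeight (fun t i => digitWeight b d u t i) k : ℂ) : ℂ) =
        ∏ t, ∏ i : Fin m, (ZMod.stdAddChar (k t i * quotCoeff p (digitPoly b n * q t) i) *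
          ((if k t i = 0 then 1 else digitWeight b d u t i : ℝ) : ℂ)) := by
      intro k
      unfold supportWeight
      push_cast
      simp_rw [Finset.prod_mul_distrib, stdAddChar_sum]
    simp_rw [h2]
    rw [sum_prod_prod (fun t (i : Fin m) c =>
      (ZMod.stdAddChar (c * quotCoeff p (digitPoly b n * q t) i) *
          ((if c = 0 then 1 else digitWeight b d u t i : ℝ) : ℂ)))]
    refine Finset.prod_congr rfl fun t _ => ?_
    rw [Finset.prod_range]
    refine Finset.prod_congr rfl fun i _ => ?_
    have h3 := digits_latticePoint m q p n t i
    rw [latticeDigit, if_pos i.isLt] at h3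
    rw [← one_add_eta_mul _ _ h3]
    simp [digitWeight, div_eq_mul_inv]
  simp_rw [h1]
  rw [Finset.sum_comm, Finset.sum_div]
  refine Finset.sum_congr rfl fun k _ => ?_
  rw [← Finset.sum_mul, sum_stdAddChar_quotCoeff hp hm]
  split_ifs
  · rw [mul_div_right_comm, div_self (pow_ne_zero _ hb), one_mul]
  · simp

end InterlacedLattice

namespace InterlacedLattice

variable {b : ℕ} [hbp : Fact b.Prime]

/-! ### The component-by-component construction -/

theorem rpow_sum_le_sum_rpow {ι : Type*} (s : Finset ι) (f : ι → ℝ) (hf : ∀ i ∈ s, 0 ≤ f i)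
    {lam : ℝ} (h0 : 0 < lam) (h1 : lam ≤ 1) :
    (∑ i ∈ s, f i) ^ lam ≤ ∑ i ∈ s, f i ^ lam := by
  classical
  induction s using Finset.induction_on with
  | empty => simp [Real.zero_rpow h0.ne']
  | insert a s ha ih =>
    rw [Finset.sum_insert ha, Finset.sum_insert ha]
    refine (Real.rpow_add_le_add_rpow (hf a (by simp)) (Finset.sum_nonneg fun i hi =>
      hf i (by simp [hi])) h0.le h1).trans ?_
    gcongr
    exact ih fun i hi => hf i (by simp [hi])

/-- The product of the weights `w i` over the support of `κ`. -/
def rowWeight {m : ℕ} (w : Fin m → ℝ) (κ : Fin m → ZMod b) : ℝ :=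
  ∏ i, if κ i = 0 then 1 else w i

theorem rowWeight_nonneg {m : ℕ} {w : Fin m → ℝ} (hw : ∀ i, 0 ≤ w i)
    (κ : Fin m → ZMod b) : 0 ≤ rowWeight w κ :=
  Finset.prod_nonneg fun i _ => by split_ifs <;> [exact zero_le_one; exact hw i]

open scoped Classical in
/-- The sum of the weights over the dual lattice. -/
def dualSum {τ : ℕ} (m : ℕ) (w : ℕ → ℕ → ℝ) (p : (ZMod b)[X]) (q : Fin τ → (ZMod b)[X]) : ℝ :=
  ∑ k : Fin τ → Fin m → ZMod b,
    if IsDual p q k then supportWeight (fun t i => w t i) k else 0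

open scoped Classical in
/-- The part of the sum over the dual lattice in which the last component does not vanish. -/
def lastSum {τ : ℕ} (m : ℕ) (w : ℕ → ℕ → ℝ) (p : (ZMod b)[X]) (q : Fin τ → (ZMod b)[X])
    (q' : (ZMod b)[X]) : ℝ :=
  ∑ κ ∈ Finset.univ.erase (0 : Fin m → ZMod b), ∑ k : Fin τ → Fin m → ZMod b,
    if p ∣ (∑ t, coeffPoly (k t) * q t) + coeffPoly κ * q' then
      supportWeight (fun t i => w t i) k * rowWeight (fun i => w τ i) κ else 0

theorem sum_snoc {V M : Type*} [Fintype V] [AddCommMonoid M] {τ : ℕ}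
    (F : (Fin (τ + 1) → V) → M) :
    ∑ k, F k = ∑ κ : V, ∑ k : Fin τ → V, F (Fin.snoc (α := fun _ => V) k κ) := by
  rw [← Fintype.sum_prod_type']
  exact ((Fin.snocEquiv fun _ => V).sum_comp F).symm

theorem supportWeight_snoc {τ m : ℕ} (w : ℕ → ℕ → ℝ) (k : Fin τ → Fin m → ZMod b)
    (κ : Fin m → ZMod b) :
    supportWeight (fun t i => w t i) (Fin.snoc (α := fun _ => Fin m → ZMod b) k κ) =
      supportWeight (fun t i => w t i) k * rowWeight (fun i => w τ i) κ := by
  unfold supportWeight rowWeight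
  rw [Fin.prod_univ_castSucc]
  simp only [Fin.snoc_castSucc, Fin.snoc_last, Fin.val_castSucc, Fin.val_last]

theorem isDual_snoc {τ m : ℕ} (p : (ZMod b)[X]) (q : Fin τ → (ZMod b)[X]) (q' : (ZMod b)[X])
    (k : Fin τ → Fin m → ZMod b) (κ : Fin m → ZMod b) :
    IsDual p (Fin.snoc (α := fun _ => (ZMod b)[X]) q q')
      (Fin.snoc (α := fun _ => Fin m → ZMod b) k κ) ↔
      p ∣ (∑ t, coeffPoly (k t) * q t) + coeffPoly κ * q' := by
  unfold IsDual
  rw [Fin.sum_univ_castSucc]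
  simp only [Fin.snoc_castSucc, Fin.snoc_last]

/-- The terms with vanishing last digit vector do not involve `q'`, so minimizing the criterion over
the new component means minimizing `lastSum`. -/
theorem dualSum_snoc {τ m : ℕ} (w : ℕ → ℕ → ℝ) (p : (ZMod b)[X])
    (q : Fin τ → (ZMod b)[X]) (q' : (ZMod b)[X]) :
    dualSum m w p (Fin.snoc (α := fun _ => (ZMod b)[X]) q q') =
      dualSum m w p q + lastSum m w p q q' := by
  classical
  unfold dualSum lastSum
  rw [sum_snoc, ← Finset.add_sum_erase _ _ (Finset.mem_univ 0)]
  simp only [isDual_snoc, supportWeight_snoc]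
  congr 1
  refine Finset.sum_congr rfl fun k _ => ?_
  rw [coeffPoly_zero, zero_mul, add_zero]
  have : rowWeight (fun i : Fin m => w τ i) (0 : Fin m → ZMod b) = 1 := by simp [rowWeight]
  rw [this, mul_one]
  rfl

theorem one_le_dualSum {τ m : ℕ} {w : ℕ → ℕ → ℝ} (hw : ∀ t i, 0 ≤ w t i) (p : (ZMod b)[X])
    (q : Fin τ → (ZMod b)[X]) : 1 ≤ dualSum m w p q := by
  classical
  unfold dualSum
  have h0 : IsDual p q (0 : Fin τ → Fin m → ZMod b) := by
    simp [IsDual, coeffPoly_zero]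
  refine le_trans (le_of_eq ?_) (Finset.single_le_sum (fun k _ => ?_) (Finset.mem_univ
    (0 : Fin τ → Fin m → ZMod b)))
  · rw [if_pos h0, supportWeight_zero]
  · split_ifs
    · exact supportWeight_nonneg (fun t i => hw t i) k
    · exact le_rfl

theorem lastSum_nonneg {τ m : ℕ} {w : ℕ → ℕ → ℝ} (hw : ∀ t i, 0 ≤ w t i) (p : (ZMod b)[X])
    (q : Fin τ → (ZMod b)[X]) (q' : (ZMod b)[X]) : 0 ≤ lastSum m w p q q' := by
  classical
  refine Finset.sum_nonneg fun κ _ => Finset.sum_nonneg fun k _ => ?_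
  split_ifs
  · exact mul_nonneg (supportWeight_nonneg (fun t i => hw t i) k) (rowWeight_nonneg (fun i => hw τ i) κ)
  · exact le_rfl

theorem coeffPoly_not_dvd {m : ℕ} {p : (ZMod b)[X]} (hm : p.natDegree = m) {κ : Fin m → ZMod b}
    (hκ : κ ≠ 0) : ¬ p ∣ coeffPoly κ := by
  intro h
  apply hκ
  rw [← coeffPoly_eq_zero_iff]
  by_contra hne
  have h1 := Polynomial.natDegree_le_of_dvd h hne
  have h2 := (Polynomial.natDegree_lt_iff_degree_lt hne).2 (coeffPoly_degree κ)
  omega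

open scoped Classical in
-- Modulo the irreducible `p` the polynomial of `κ ≠ 0` is invertible, so the congruence fixes `a`
-- modulo `p`; the degree bound then fixes `a`.
theorem card_dvd_le_one {m : ℕ} {p : (ZMod b)[X]} (hp : Irreducible p) (hm : p.natDegree = m)
    (A : (ZMod b)[X]) {κ : Fin m → ZMod b} (hκ : κ ≠ 0) (s : Finset (Fin m → ZMod b)) :
    (s.filter fun a => p ∣ A + coeffPoly κ * coeffPoly a).card ≤ 1 := by
  rw [Finset.card_le_one]
  intro a ha a' ha'
  rw [Finset.mem_filter] at ha ha'
  have h1 := dvd_sub ha.2 ha'.2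
  rw [add_sub_add_left_eq_sub, ← mul_sub, ← coeffPoly_sub] at h1
  rcases hp.prime.dvd_or_dvd h1 with h | h
  · exact absurd h (coeffPoly_not_dvd hm hκ)
  · by_contra hne
    exact coeffPoly_not_dvd hm (sub_ne_zero.2 hne) h

theorem card_erase_zero (m : ℕ) :
    (((Finset.univ.erase (0 : Fin m → ZMod b)).card : ℕ) : ℝ) = (b : ℝ) ^ m - 1 := by
  rw [Finset.card_erase_of_mem (Finset.mem_univ _), Nat.cast_sub]
  · simp [ZMod.card]
  · exact Finset.card_pos.2 ⟨0, Finset.mem_univ _⟩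

/-- Minimum against average over the `b^m - 1` candidates. The power `lam` is taken inside the sums
by subadditivity, and after the order of summation is exchanged each pair `(k, κ)` is counted for at
most one candidate. -/
theorem lastSum_average {τ m : ℕ} {w : ℕ → ℕ → ℝ} (hw : ∀ t i, 0 ≤ w t i) {p : (ZMod b)[X]}
    (hp : Irreducible p) (hm : p.natDegree = m) (q : Fin τ → (ZMod b)[X]) {θ lam : ℝ}
    (hθ : 0 ≤ θ) (h0 : 0 < lam) (h1 : lam ≤ 1)
    (h : ∀ a : Fin m → ZMod b, a ≠ 0 → θ ≤ lastSum m w p q (coeffPoly a)) :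
    ((b : ℝ) ^ m - 1) * θ ^ lam ≤
      ∑ κ ∈ Finset.univ.erase (0 : Fin m → ZMod b), ∑ k : Fin τ → Fin m → ZMod b,
        supportWeight (fun t i => w t i ^ lam) k * rowWeight (fun i => w τ i ^ lam) κ := by
  classical
  set S := Finset.univ.erase (0 : Fin m → ZMod b) with hS
  set W : (Fin τ → Fin m → ZMod b) → (Fin m → ZMod b) → ℝ := fun k κ =>
    supportWeight (fun t i => w t i) k * rowWeight (fun i => w τ i) κ with hW
  have hW0 : ∀ k κ, 0 ≤ W k κ := fun k κ =>
    mul_nonneg (supportWeight_nonneg (fun t i => hw t i) k) (rowWeight_nonneg (fun i => hw τ i) κ)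
  have hWl : ∀ k κ, W k κ ^ lam =
      supportWeight (fun t i => w t i ^ lam) k * rowWeight (fun i => w τ i ^ lam) κ := by
    intro k κ
    have e1 := supportWeight_rpow (τ := τ + 1) (fun t (i : Fin m) => hw t i) lam
      (Fin.snoc (α := fun _ => Fin m → ZMod b) k κ)
    rw [supportWeight_snoc] at e1
    rw [hW]
    simp only
    rw [e1]
    exact supportWeight_snoc (fun t i => w t i ^ lam) k κ
  have step : ∀ a ∈ S, θ ^ lam ≤ ∑ κ ∈ S, ∑ k : Fin τ → Fin m → ZMod b,
      if p ∣ (∑ t, coeffPoly (k t) * q t) + coeffPoly κ * coeffPoly a then W k κ ^ lam else 0 := by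
    intro a ha
    refine (Real.rpow_le_rpow hθ (h a (Finset.ne_of_mem_erase ha)) h0.le).trans ?_
    unfold lastSum
    have hn : ∀ (k : Fin τ → Fin m → ZMod b) (κ : Fin m → ZMod b), 0 ≤ (if p ∣ (∑ t, coeffPoly (k t) * q t) + coeffPoly κ * coeffPoly a then
        supportWeight (fun t i => w t i) k * rowWeight (fun i => w τ i) κ else 0 : ℝ) := by
      intro k κ
      split_ifs <;> [exact hW0 k κ; exact le_rfl]
    refine (rpow_sum_le_sum_rpow _ _ (fun κ _ => Finset.sum_nonneg fun k _ => hn k κ) h0 h1).trans ?_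
    refine (Finset.sum_le_sum fun κ _ => rpow_sum_le_sum_rpow _ _ (fun k _ => hn k κ) h0 h1).trans ?_
    refine le_of_eq ?_
    refine Finset.sum_congr rfl fun κ _ => Finset.sum_congr rfl fun k _ => ?_
    split_ifs
    · rfl
    · exact Real.zero_rpow h0.ne'
  calc ((b : ℝ) ^ m - 1) * θ ^ lam = ∑ a ∈ S, θ ^ lam := by
        rw [Finset.sum_const, nsmul_eq_mul, hS, card_erase_zero]
    _ ≤ _ := Finset.sum_le_sum step
    _ = ∑ κ ∈ S, ∑ k : Fin τ → Fin m → ZMod b,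
        ((S.filter fun a => p ∣ (∑ t, coeffPoly (k t) * q t) + coeffPoly κ * coeffPoly a).card : ℝ) *
          W k κ ^ lam := by
        rw [Finset.sum_comm]
        refine Finset.sum_congr rfl fun κ _ => ?_
        rw [Finset.sum_comm]
        refine Finset.sum_congr rfl fun k _ => ?_
        rw [← Finset.sum_filter, Finset.sum_const, nsmul_eq_mul]
    _ ≤ _ := by
        refine Finset.sum_le_sum fun κ hκ => Finset.sum_le_sum fun k _ => ?_
        rw [← hWl]
        have h2 := card_dvd_le_one hp hm (∑ t, coeffPoly (k t) * q t)
          (Finset.ne_of_mem_erase hκ) S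
        exact mul_le_of_le_one_left (Real.rpow_nonneg (hW0 k κ) _) (by exact_mod_cast h2)

theorem coeffPoly_mem_candidates {m : ℕ} {a : Fin m → ZMod b} (ha : a ≠ 0) :
    coeffPoly a ∈ candidates b m :=
  ⟨fun h => ha ((coeffPoly_eq_zero_iff a).1 h), coeffPoly_degree a⟩

theorem castLE_eq_snoc {α : Type*} {τ n : ℕ} (h : τ < n) (q : Fin n → α) :
    (fun t : Fin (τ + 1) => q (Fin.castLE h t)) =
      Fin.snoc (α := fun _ => α) (fun t : Fin τ => q (Fin.castLE h.le t)) (q ⟨τ, h⟩) := by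
  funext t
  induction t using Fin.lastCases with
  | last => rw [Fin.snoc_last]; rfl
  | cast t => rw [Fin.snoc_castSucc]; rfl

/-- Induction on the number of components: `dualSum - 1` grows by `θ`, the power `lam` is
subadditive, and the right-hand side splits in the same way into the terms with `κ = 0` and those
with `κ ≠ 0`. -/
theorem IsCBC.dualSum_le {m s d : ℕ} {u : ℕ → ℝ} {p : (ZMod b)[X]} (hp : Irreducible p)
    (hm : p.natDegree = m) {q : Fin (s * d) → (ZMod b)[X]} (hq : IsCBC b m s d u p q)
    {lam : ℝ} (h0 : 0 < lam) (h1 : lam ≤ 1) (τ : ℕ) (hτ : τ ≤ s * d) :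
    ((b : ℝ) ^ m - 1) * (dualSum m (digitWeight b d u) p
      (fun t : Fin τ => q (Fin.castLE hτ t)) - 1) ^ lam ≤
      ∑ k : Fin τ → Fin m → ZMod b, supportWeight (fun t i => digitWeight b d u t i ^ lam) k := by
  classical
  have hw : ∀ t i, 0 ≤ digitWeight b d u t i := fun t i => (digitWeight_pos d u t i).le
  have hbm : 0 ≤ (b : ℝ) ^ m - 1 := by
    have : (1 : ℝ) ≤ b := by exact_mod_cast hbp.out.one_le
    linarith [one_le_pow₀ this (n := m)]
  induction τ with
  | zero =>
    have e1 : dualSum m (digitWeight b d u) p (fun t : Fin 0 => q (Fin.castLE hτ t)) = 1 := by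
      simp [dualSum, IsDual, supportWeight]
    rw [e1, sub_self, Real.zero_rpow h0.ne', mul_zero]
    exact Finset.sum_nonneg fun k _ => supportWeight_nonneg (fun t i =>
      Real.rpow_nonneg (hw t i) _) k
  | succ τ ih =>
    have hlt : τ < s * d := hτ
    have ih := ih hlt.le
    rw [castLE_eq_snoc hlt, dualSum_snoc]
    set q₀ := fun t : Fin τ => q (Fin.castLE hlt.le t) with hq₀
    set θ := lastSum m (digitWeight b d u) p q₀ (q ⟨τ, hlt⟩) with hθ
    have hθ0 : 0 ≤ θ := lastSum_nonneg hw p q₀ _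
    have hB := one_le_dualSum hw (m := m) p q₀
    have hmin : ∀ a : Fin m → ZMod b, a ≠ 0 →
        θ ≤ lastSum m (digitWeight b d u) p q₀ (coeffPoly a) := by
      intro a ha
      -- The first component is prescribed rather than minimized; since it is 1, its `lastSum` is
      -- zero, which is minimal anyway.
      rcases Nat.eq_zero_or_pos τ with rfl | hpos
      · have : θ = 0 := by
          rw [hθ, hq.1 hlt]
          unfold lastSum
          refine Finset.sum_eq_zero fun κ hκ => Finset.sum_eq_zero fun k _ => ?_
          rw [if_neg]
          simpa using coeffPoly_not_dvd hm (Finset.ne_of_mem_erase hκ)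
        rw [this]
        exact lastSum_nonneg hw p q₀ _
      · have h2 := (hq.2 τ hpos hlt).2 _ (coeffPoly_mem_candidates ha)
        have h3 := add_le_add_right h2 1
        rw [merit_eq_sum u hp.ne_zero hm, merit_eq_sum u hp.ne_zero hm, castLE_eq_snoc hlt] at h3
        change dualSum m (digitWeight b d u) p _ ≤ dualSum m (digitWeight b d u) p _ at h3
        rw [dualSum_snoc, dualSum_snoc] at h3
        exact le_of_add_le_add_left h3
    have h4 := lastSum_average hw hp hm q₀ hθ0 h0 h1 hmin
    have h5 : (dualSum m (digitWeight b d u) p q₀ + θ - 1) ^ lam ≤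
        (dualSum m (digitWeight b d u) p q₀ - 1) ^ lam + θ ^ lam := by
      rw [add_sub_right_comm]
      exact Real.rpow_add_le_add_rpow (by linarith) hθ0 h0.le h1
    refine (mul_le_mul_of_nonneg_left h5 hbm).trans ?_
    rw [mul_add, sum_snoc, ← Finset.add_sum_erase _ _ (Finset.mem_univ 0)]
    simp only [supportWeight_snoc (fun t i => digitWeight b d u t i ^ lam)]
    refine add_le_add (ih.trans (le_of_eq ?_)) h4
    refine Finset.sum_congr rfl fun k _ => ?_
    simp [rowWeight]

theorem merit_eq_dualSum {m d τ : ℕ} (u : ℕ → ℝ) {p : (ZMod b)[X]} (hp : p ≠ 0)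
    (hm : p.natDegree = m) (q : Fin τ → (ZMod b)[X]) :
    merit b m d u q p = dualSum m (digitWeight b d u) p q - 1 := by
  have := merit_eq_sum (d := d) u hp hm q
  rw [dualSum, ← this]; ring

theorem IsCBC.merit_rpow_le {m s d : ℕ} {u : ℕ → ℝ} {p : (ZMod b)[X]} (hp : Irreducible p)
    (hm : p.natDegree = m) {q : Fin (s * d) → (ZMod b)[X]} (hq : IsCBC b m s d u p q)
    {lam : ℝ} (h0 : 0 < lam) (h1 : lam ≤ 1) :
    ((b : ℝ) ^ m - 1) * merit b m d u q p ^ lam ≤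
      ∏ t : Fin (s * d), ∏ i : Fin m, (1 + (b - 1) * digitWeight b d u t i ^ lam) := by
  rw [merit_eq_dualSum u hp.ne_zero hm, ← sum_supportWeight]
  exact hq.dualSum_le hp hm h0 h1 (s * d) le_rfl

end InterlacedLattice

namespace InterlacedLattice

variable {b : ℕ} [hbp : Fact b.Prime]

/-! ### Integration by parts against Walsh functions -/

open MeasureTheory Set Filter Topology

/-- The character `e(c ξ)` of the digit `ξ` of `x` at `b^{-(l+1)}`. -/
def digitChar (c : ZMod b) (l : ℕ) (x : ℝ) : ℂ :=
  ZMod.stdAddChar (c * ((⌊x * (b : ℝ) ^ (l + 1)⌋ : ℤ) : ZMod b))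

/-- The Walsh function with the digits `κ 0, …, κ (M - 1)`. -/
def walsh (κ : ℕ → ZMod b) (M : ℕ) (x : ℝ) : ℂ := ∏ l ∈ Finset.range M, digitChar (κ l) l x

theorem norm_stdAddChar (x : ZMod b) : ‖(ZMod.stdAddChar x : ℂ)‖ = 1 := by
  rw [ZMod.stdAddChar_apply, Circle.norm_coe]

theorem norm_digitChar (c : ZMod b) (l : ℕ) (x : ℝ) : ‖digitChar c l x‖ = 1 :=
  norm_stdAddChar _

theorem measurable_digitChar (c : ZMod b) (l : ℕ) : Measurable (digitChar c l) := by
  have h : Measurable fun n : ℤ => (ZMod.stdAddChar (c * ((n : ℤ) : ZMod b)) : ℂ) :=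
    measurable_from_top
  exact h.comp (Int.measurable_floor.comp (measurable_id.mul_const _))

theorem norm_walsh (κ : ℕ → ZMod b) (M : ℕ) (x : ℝ) : ‖walsh κ M x‖ = 1 := by
  simp [walsh, norm_digitChar]

theorem measurable_walsh (κ : ℕ → ZMod b) (M : ℕ) : Measurable (walsh κ M) :=
  Finset.measurable_fun_prod _ fun l _ => measurable_digitChar _ l

theorem cast_pos : (0 : ℝ) < b := by exact_mod_cast hbp.out.pos

/-- The floor function is right continuous. This supplies right derivatives of primitives, so that
integration by parts tolerates the jumps. -/
theorem digitChar_rightContinuous (c : ZMod b) (l : ℕ) (x : ℝ) :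
    ContinuousWithinAt (digitChar c l) (Ici x) x := by
  have hB : (0 : ℝ) < (b : ℝ) ^ (l + 1) := pow_pos cast_pos _
  have h1 : Tendsto (fun y : ℝ => y * (b : ℝ) ^ (l + 1)) (𝓝[≥] x) (𝓝[≥] (x * (b : ℝ) ^ (l + 1))) := by
    apply tendsto_nhdsWithin_of_tendsto_nhds_of_eventually_within
    · exact ((continuous_id.mul continuous_const).tendsto x).mono_left inf_le_left
    · filter_upwards [self_mem_nhdsWithin] with y hy
      exact mul_le_mul_of_nonneg_right hy hB.le
  have h2 := (tendsto_floor_right_pure_floor (x * (b : ℝ) ^ (l + 1))).comp h1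
  have h3 : ∀ᶠ y in 𝓝[≥] x, ⌊y * (b : ℝ) ^ (l + 1)⌋ = ⌊x * (b : ℝ) ^ (l + 1)⌋ := tendsto_pure.1 h2
  refine tendsto_const_nhds.congr' ?_
  filter_upwards [h3] with y hy
  rw [digitChar, digitChar, hy]

theorem digitChar_shift (c : ZMod b) (l : ℕ) (x : ℝ) (n : ℕ) :
    digitChar c l (x + n * ((b : ℝ) ^ (l + 1))⁻¹) =
      ZMod.stdAddChar (c * (n : ZMod b)) * digitChar c l x := by
  have hB : (b : ℝ) ^ (l + 1) ≠ 0 := (pow_pos cast_pos _).ne'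
  rw [digitChar, digitChar, ← AddChar.map_add_eq_mul, ← mul_add, add_mul, inv_mul_cancel_right₀ hB,
    Int.floor_add_natCast]
  push_cast
  rw [add_comm]

theorem digitChar_periodic (c : ZMod b) (l : ℕ) :
    Function.Periodic (digitChar c l) ((b : ℝ) ^ l)⁻¹ := by
  intro x
  have hB : (b : ℝ) ≠ 0 := cast_pos.ne'
  have h := digitChar_shift c l x b
  rw [ZMod.natCast_self, mul_zero, AddChar.map_zero_eq_one, one_mul] at h
  rw [← h, pow_succ, mul_inv_rev, mul_inv_cancel_left₀ hB]

theorem walsh_eq_on_cell (κ : ℕ → ZMod b) (M n : ℕ) {x : ℝ}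
    (hx : x ∈ Ico ((n : ℝ) * ((b : ℝ) ^ M)⁻¹) (((n + 1 : ℕ) : ℝ) * ((b : ℝ) ^ M)⁻¹)) :
    walsh κ M x = walsh κ M ((n : ℝ) * ((b : ℝ) ^ M)⁻¹) := by
  have hB : (0 : ℝ) < (b : ℝ) ^ M := pow_pos cast_pos _
  refine Finset.prod_congr rfl fun l hl => ?_
  have hl' : l + 1 ≤ M := Finset.mem_range.1 hl
  have hfl : ∀ y ∈ Ico ((n : ℝ) * ((b : ℝ) ^ M)⁻¹) (((n + 1 : ℕ) : ℝ) * ((b : ℝ) ^ M)⁻¹),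
      ⌊y * (b : ℝ) ^ (l + 1)⌋ = ((n / b ^ (M - (l + 1)) : ℕ) : ℤ) := by
    intro y hy
    have hy0 : 0 ≤ y := le_trans (by positivity) hy.1
    have h1 : ⌊y * (b : ℝ) ^ M⌋₊ = n := by
      rw [Nat.floor_eq_iff (by positivity)]
      have a1 := mul_le_mul_of_nonneg_right hy.1 hB.le
      have a2 := mul_lt_mul_of_pos_right hy.2 hB
      rw [inv_mul_cancel_right₀ hB.ne'] at a1 a2
      exact ⟨a1, by exact_mod_cast a2⟩
    have h2 : y * (b : ℝ) ^ (l + 1) = (y * (b : ℝ) ^ M) / ((b ^ (M - (l + 1)) : ℕ) : ℝ) := by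
      have hb0 : (b : ℝ) ≠ 0 := cast_pos.ne'
      push_cast
      rw [eq_div_iff (pow_ne_zero _ hb0), mul_assoc, ← pow_add]
      congr 2; omega
    rw [← Int.natCast_floor_eq_floor (by positivity), h2, Nat.floor_div_natCast, h1]
  rw [digitChar, digitChar, hfl x hx, hfl _ ⟨le_rfl, ?_⟩]
  push_cast
  have := inv_pos.2 hB
  nlinarith

/-- `∫ g φ = ∫ g^{(n)} ψ` on `[0,1]` for every smooth `g`, which is given together with its
derivatives. -/
def ReducesTo (n : ℕ) (φ ψ : ℝ → ℂ) : Prop :=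
  ∀ g : ℕ → ℝ → ℝ, (∀ i, ContinuousOn (g i) (Icc 0 1)) →
    (∀ i, ∀ t ∈ Icc (0 : ℝ) 1, HasDerivWithinAt (g i) (g (i + 1) t) (Icc 0 1) t) →
    ∫ t in (0 : ℝ)..1, (g 0 t : ℂ) * φ t = ∫ t in (0 : ℝ)..1, (g n t : ℂ) * ψ t

theorem intervalIntegrable_of_bounded {w : ℝ → ℂ} (hw : Measurable w) {H : ℝ}
    (hH : ∀ x, ‖w x‖ ≤ H) (x y : ℝ) : IntervalIntegrable w volume x y := by
  refine (intervalIntegrable_const (c := H)).mono_fun hw.aestronglyMeasurable ?_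
  exact Eventually.of_forall fun t => (hH t).trans (le_abs_self H)

/-- On each cell of length `b^{-M}` the Walsh factor is constant, and the primitive of `w` vanishes
at both ends, so integration by parts leaves no boundary terms. -/
theorem integral_walsh_step {g g' : ℝ → ℝ} (hg : ContinuousOn g (Icc 0 1))
    (hg' : ContinuousOn g' (Icc 0 1))
    (hd : ∀ t ∈ Icc (0 : ℝ) 1, HasDerivWithinAt g (g' t) (Icc 0 1) t)
    (κ : ℕ → ZMod b) (M : ℕ) {w : ℝ → ℂ} (hw : Measurable w) {H : ℝ} (hH : ∀ x, ‖w x‖ ≤ H)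
    (hrc : ∀ x, ContinuousWithinAt w (Ici x) x)
    (h0 : ∀ n : ℕ, ∫ t in (0 : ℝ)..(n * ((b : ℝ) ^ M)⁻¹), w t = 0) :
    ∫ t in (0 : ℝ)..1, (g t : ℂ) * (walsh κ M t * w t) =
      ∫ t in (0 : ℝ)..1, (g' t : ℂ) * (walsh κ M t * -∫ y in (0 : ℝ)..t, w y) := by
  set P := ((b : ℝ) ^ M)⁻¹ with hP
  have hB : (0 : ℝ) < (b : ℝ) ^ M := pow_pos cast_pos _
  have hP0 : 0 < P := inv_pos.2 hB
  set W : ℝ → ℂ := fun t => ∫ y in (0 : ℝ)..t, w y with hW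
  have hwi := intervalIntegrable_of_bounded hw hH
  have hWc : Continuous W := intervalIntegral.continuous_primitive hwi 0
  have hgC : ContinuousOn (fun t => (g t : ℂ)) (Icc 0 1) :=
    Complex.continuous_ofReal.comp_continuousOn hg
  have hg'C : ContinuousOn (fun t => (g' t : ℂ)) (Icc 0 1) :=
    Complex.continuous_ofReal.comp_continuousOn hg'
  have hwalsh : ∀ (f : ℝ → ℂ) x y, IntervalIntegrable f volume x y →
      IntervalIntegrable (fun t => walsh κ M t * f t) volume x y := by
    intro f x y hf
    refine hf.mono_fun ((measurable_walsh κ M).aestronglyMeasurable.mul ?_) ?_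
    · exact hf.aestronglyMeasurable_restrict_uIoc
    · refine Eventually.of_forall fun t => ?_
      simp only [norm_mul, norm_walsh, one_mul, le_refl]
  have hcell : ∀ n : ℕ, n < b ^ M → Icc ((n : ℝ) * P) (((n + 1 : ℕ) : ℝ) * P) ⊆ Icc 0 1 := by
    intro n hn x hx
    refine ⟨le_trans (by positivity) hx.1, hx.2.trans ?_⟩
    rw [hP, ← div_eq_mul_inv, div_le_one hB]
    exact_mod_cast hn
  have hle : ∀ n : ℕ, (n : ℝ) * P ≤ ((n + 1 : ℕ) : ℝ) * P := fun n => by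
    gcongr; simp
  have i1 : ∀ n < b ^ M, IntervalIntegrable (fun t => (g t : ℂ) * (walsh κ M t * w t)) volume
      ((n : ℝ) * P) (((n + 1 : ℕ) : ℝ) * P) := by
    intro n hn
    refine IntervalIntegrable.continuousOn_mul (hwalsh w _ _ (hwi _ _)) ?_
    rw [uIcc_of_le (hle n)]
    exact hgC.mono (hcell n hn)
  have i2 : ∀ n < b ^ M, IntervalIntegrable (fun t => (g' t : ℂ) * (walsh κ M t * -W t)) volume
      ((n : ℝ) * P) (((n + 1 : ℕ) : ℝ) * P) := by
    intro n hn
    refine IntervalIntegrable.continuousOn_mul (hwalsh _ _ _ (hWc.neg.intervalIntegrable _ _)) ?_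
    rw [uIcc_of_le (hle n)]
    exact hg'C.mono (hcell n hn)
  have e1 := intervalIntegral.sum_integral_adjacent_intervals (a := fun n : ℕ => (n : ℝ) * P) i1
  have e2 := intervalIntegral.sum_integral_adjacent_intervals (a := fun n : ℕ => (n : ℝ) * P) i2
  have hend : ((b ^ M : ℕ) : ℝ) * P = 1 := by
    push_cast; exact mul_inv_cancel₀ hB.ne'
  simp only [Nat.cast_zero, zero_mul, hend] at e1 e2
  rw [← e1]
  refine Eq.trans ?_ e2
  refine Finset.sum_congr rfl fun n hn => ?_
  have hn' := Finset.mem_range.1 hn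
  have hsub := hcell n hn'
  have c1 : ∫ t in ((n : ℝ) * P)..(((n + 1 : ℕ) : ℝ) * P), (g t : ℂ) * (walsh κ M t * w t) =
      walsh κ M ((n : ℝ) * P) * ∫ t in ((n : ℝ) * P)..(((n + 1 : ℕ) : ℝ) * P), (g t : ℂ) * w t := by
    rw [← intervalIntegral.integral_const_mul]
    refine intervalIntegral.integral_congr_Ioo_of_le (hle n) fun t ht => ?_
    rw [walsh_eq_on_cell κ M n ⟨ht.1.le, ht.2⟩]; ring
  have c2 : ∫ t in ((n : ℝ) * P)..(((n + 1 : ℕ) : ℝ) * P), (g' t : ℂ) * (walsh κ M t * -W t) =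
      walsh κ M ((n : ℝ) * P) *
        -∫ t in ((n : ℝ) * P)..(((n + 1 : ℕ) : ℝ) * P), (g' t : ℂ) * W t := by
    rw [← intervalIntegral.integral_neg, ← intervalIntegral.integral_const_mul]
    refine intervalIntegral.integral_congr_Ioo_of_le (hle n) fun t ht => ?_
    rw [walsh_eq_on_cell κ M n ⟨ht.1.le, ht.2⟩]; ring
  rw [c1, c2]
  congr 1
  have hI : uIcc ((n : ℝ) * P) (((n + 1 : ℕ) : ℝ) * P) ⊆ Icc 0 1 := by
    rw [uIcc_of_le (hle n)]; exact hsub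
  rw [intervalIntegral.integral_mul_deriv_eq_deriv_mul_of_hasDeriv_right (v := W)
    (u' := fun t => (g' t : ℂ)) (hgC.mono hI) hWc.continuousOn ?_ ?_
    ((hg'C.mono hI).intervalIntegrable) (hwi _ _)]
  · have z1 : W ((n : ℝ) * P) = 0 := h0 n
    have z2 : W (((n + 1 : ℕ) : ℝ) * P) = 0 := h0 (n + 1)
    rw [z1, z2]; simp
  · intro x hx
    rw [min_eq_left (hle n), max_eq_right (hle n)] at hx
    have hx01 : x ∈ Ioo (0 : ℝ) 1 := by
      have l := hsub (left_mem_Icc.2 (hle n))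
      have r := hsub (right_mem_Icc.2 (hle n))
      exact ⟨l.1.trans_lt hx.1, hx.2.trans_le r.2⟩
    have := (hd x (Ioo_subset_Icc_self hx01)).hasDerivAt (Icc_mem_nhds hx01.1 hx01.2)
    exact this.ofReal_comp.hasDerivWithinAt
  · intro x _
    have : HasDerivWithinAt W (w x) (Ici x) x :=
      intervalIntegral.integral_hasDerivWithinAt_right (hwi 0 x)
        (hw.stronglyMeasurable.stronglyMeasurableAtFilter) ((hrc x).mono Ioi_subset_Ici_self)
    exact this.mono Ioi_subset_Ici_self

theorem integral_zero_of_periodic {w : ℝ → ℂ} {P : ℝ} (hp : Function.Periodic w P)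
    (hi : ∀ x y, IntervalIntegrable w volume x y)
    (h : ∫ t in (0 : ℝ)..P, w t = 0) (n : ℕ) : ∫ t in (0 : ℝ)..(n * P), w t = 0 := by
  induction n with
  | zero => simp
  | succ n ih =>
    rw [← intervalIntegral.integral_add_adjacent_intervals (hi 0 (n * P)) (hi _ _), ih, zero_add]
    have := hp.intervalIntegral_add_eq (n * P) 0
    rw [zero_add, h] at this
    rw [← this]
    congr 1; push_cast; ring

theorem walsh_succ (κ : ℕ → ZMod b) (M : ℕ) (x : ℝ) :
    walsh κ (M + 1) x = walsh κ M x * digitChar (κ M) M x := by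
  rw [walsh, Finset.prod_range_succ]; rfl

/-- Digits are removed from the finest to the coarsest, while the accumulated factor `h` stays
bounded, right continuous and `b^{-M}`-periodic. A zero digit costs nothing. A nonzero digit makes
`digitChar * h` have mean zero over a period, so its primitive is again periodic and smaller by
`b^{-M}`, and one derivative passes to `g`. -/
theorem exists_reducesTo_walsh_mul (κ : ℕ → ZMod b) (M : ℕ) (h : ℝ → ℂ) (H : ℝ)
    (hm : Measurable h) (hH : ∀ x, ‖h x‖ ≤ H) (hrc : ∀ x, ContinuousWithinAt h (Ici x) x)
    (hper : Function.Periodic h ((b : ℝ) ^ M)⁻¹) :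
    ∃ ψ : ℝ → ℂ, Measurable ψ ∧
      (∀ x, ‖ψ x‖ ≤ H * ∏ l ∈ Finset.range M, if κ l = 0 then 1 else ((b : ℝ) ^ l)⁻¹) ∧
      ReducesTo (∑ l ∈ Finset.range M, if κ l = 0 then 0 else 1) (fun x => walsh κ M x * h x) ψ := by
  have hb0 : (b : ℝ) ≠ 0 := cast_pos.ne'
  induction M generalizing h H with
  | zero =>
    refine ⟨h, hm, by simpa using hH, fun g _ _ => ?_⟩
    simp [walsh]
  | succ M ih =>
    set P := ((b : ℝ) ^ M)⁻¹ with hP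
    have hP0 : 0 < P := inv_pos.2 (pow_pos cast_pos _)
    have hperP : Function.Periodic h P := by
      have := hper.nat_mul b
      rwa [pow_succ, mul_inv_rev, mul_inv_cancel_left₀ hb0] at this
    by_cases hk : κ M = 0
    · obtain ⟨ψ, h1, h2, h3⟩ := ih h H hm hH hrc hperP
      refine ⟨ψ, h1, ?_, ?_⟩
      · rw [Finset.prod_range_succ, if_pos hk, mul_one]; exact h2
      · rw [Finset.sum_range_succ, if_pos hk, add_zero]
        have : (fun x => walsh κ (M + 1) x * h x) = fun x => walsh κ M x * h x := by
          funext x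
          rw [walsh_succ, hk, digitChar, zero_mul, AddChar.map_zero_eq_one, mul_one]
        rw [this]; exact h3
    · set w : ℝ → ℂ := fun x => digitChar (κ M) M x * h x with hw
      have hwm : Measurable w := (measurable_digitChar _ _).mul hm
      have hwH : ∀ x, ‖w x‖ ≤ H := fun x => by
        rw [hw, norm_mul, norm_digitChar, one_mul]; exact hH x
      have hwrc : ∀ x, ContinuousWithinAt w (Ici x) x := fun x =>
        (digitChar_rightContinuous _ _ x).mul (hrc x)
      have hwper : Function.Periodic w P := (digitChar_periodic (κ M) M).mul hperP
      have hwi := intervalIntegrable_of_bounded hwm hwH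
      have hshift : ∀ x, w (x + ((b : ℝ) ^ (M + 1))⁻¹) = ZMod.stdAddChar (κ M) * w x := by
        intro x
        have := digitChar_shift (κ M) M x 1
        simp only [Nat.cast_one, one_mul, mul_one] at this
        rw [hw]
        simp only
        rw [this, hper x, mul_assoc]
      have hzero : ∫ t in (0 : ℝ)..P, w t = 0 := by
        -- A shift by `b^{-(M+1)}` preserves the integral over a period but multiplies `w` by a
        -- character value different from 1, so the integral is zero.
        have e1 : ∫ t in (0 : ℝ)..P, w (t + ((b : ℝ) ^ (M + 1))⁻¹) = ∫ t in (0 : ℝ)..P, w t := by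
          rw [intervalIntegral.integral_comp_add_right, zero_add, add_comm P]
          have := hwper.intervalIntegral_add_eq ((b : ℝ) ^ (M + 1))⁻¹ 0
          rwa [zero_add] at this
        simp_rw [hshift] at e1
        rw [intervalIntegral.integral_const_mul] at e1
        have e2 : (ZMod.stdAddChar (κ M) - 1 : ℂ) * ∫ t in (0 : ℝ)..P, w t = 0 := by
          rw [sub_mul, one_mul, e1, sub_self]
        refine (mul_eq_zero.1 e2).resolve_left (sub_ne_zero.2 fun h => hk ?_)
        exact (stdAddChar_eq_one_iff _).1 h
      set h' : ℝ → ℂ := fun x => -∫ t in (0 : ℝ)..x, w t with hh'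
      have hc' : Continuous h' := (intervalIntegral.continuous_primitive hwi 0).neg
      have hper' : Function.Periodic h' P := by
        intro x
        rw [hh']
        simp only
        rw [← intervalIntegral.integral_add_adjacent_intervals (hwi 0 x) (hwi x (x + P))]
        have := hwper.intervalIntegral_add_eq x 0
        rw [zero_add, hzero] at this
        rw [this, add_zero]
      have hH' : ∀ x, ‖h' x‖ ≤ H * P := by
        intro x
        -- Periodicity brings the end of the primitive into one period, which is where the gain `P`
        -- comes from.
        obtain ⟨y, hy, hxy⟩ := hper'.exists_mem_Ico₀ hP0 x
        rw [hxy, hh', norm_neg]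
        refine (intervalIntegral.norm_integral_le_of_norm_le_const fun t _ => hwH t).trans ?_
        rw [sub_zero, abs_of_nonneg hy.1]
        exact mul_le_mul_of_nonneg_left hy.2.le ((norm_nonneg _).trans (hH 0))
      obtain ⟨ψ, h1, h2, h3⟩ := ih h' (H * P) hc'.measurable hH'
        (fun x => hc'.continuousWithinAt) hper'
      refine ⟨ψ, h1, fun x => (h2 x).trans (le_of_eq ?_), fun g hg hd => ?_⟩
      · rw [Finset.prod_range_succ, if_neg hk]; ring
      · rw [Finset.sum_range_succ, if_neg hk]
        have := h3 (fun i => g (i + 1)) (fun i => hg (i + 1)) (fun i => hd (i + 1))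
        simp only [zero_add] at this
        rw [← this, ← integral_walsh_step (hg 0) (hg 1) (hd 0) κ M hwm hwH hwrc
          (integral_zero_of_periodic hwper hwi hzero)]
        simp_rw [walsh_succ, hw, mul_assoc]

theorem exists_reducesTo_walsh (κ : ℕ → ZMod b) (M : ℕ) :
    ∃ ψ : ℝ → ℂ, Measurable ψ ∧
      (∀ x, ‖ψ x‖ ≤ ∏ l ∈ Finset.range M, if κ l = 0 then 1 else ((b : ℝ) ^ l)⁻¹) ∧
      ReducesTo (∑ l ∈ Finset.range M, if κ l = 0 then 0 else 1) (walsh κ M) ψ := by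
  simpa using exists_reducesTo_walsh_mul κ M (fun _ => 1) 1 measurable_const (by simp)
    (fun x => continuousWithinAt_const) (fun _ => rfl)

end InterlacedLattice

namespace InterlacedLattice

/-! ### Integration by parts on the cube -/

open MeasureTheory Set Filter Topology

theorem cube_eq_pi (s : ℕ) : cube s = Set.univ.pi fun _ => Icc (0 : ℝ) 1 := by
  rw [Set.pi_univ_Icc]; rfl

theorem uniqueDiffOn_cube (s : ℕ) : UniqueDiffOn ℝ (cube s) := by
  rw [cube_eq_pi]
  exact UniqueDiffOn.univ_pi fun _ => uniqueDiffOn_Icc zero_lt_one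

theorem measurableSet_cube (s : ℕ) : MeasurableSet (cube s) := measurableSet_Icc

theorem update_mem_cube {s : ℕ} {x : Fin s → ℝ} (hx : x ∈ cube s) (j : Fin s) {t : ℝ}
    (ht : t ∈ Icc (0 : ℝ) 1) : Function.update x j t ∈ cube s := by
  rw [cube_eq_pi] at hx ⊢
  intro i _
  rcases eq_or_ne i j with rfl | h
  · simpa using ht
  · simpa [h] using hx i (mem_univ i)

theorem contDiffOn_partialDeriv {s : ℕ} (j : Fin s) {f : (Fin s → ℝ) → ℝ}
    (hf : ContDiffOn ℝ ∞ f (cube s)) : ContDiffOn ℝ ∞ (partialDeriv j f) (cube s) :=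
  (hf.fderivWithin (uniqueDiffOn_cube s) (by simp)).clm_apply contDiffOn_const

theorem contDiffOn_partialDeriv_iterate {s : ℕ} (j : Fin s) (n : ℕ) {f : (Fin s → ℝ) → ℝ}
    (hf : ContDiffOn ℝ ∞ f (cube s)) : ContDiffOn ℝ ∞ ((partialDeriv j)^[n] f) (cube s) := by
  induction n with
  | zero => exact hf
  | succ n ih => rw [Function.iterate_succ_apply']; exact contDiffOn_partialDeriv j ih

theorem hasDerivWithinAt_update {s : ℕ} (j : Fin s) {f : (Fin s → ℝ) → ℝ}
    (hf : ContDiffOn ℝ ∞ f (cube s)) {x : Fin s → ℝ} (hx : x ∈ cube s) {t : ℝ}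
    (ht : t ∈ Icc (0 : ℝ) 1) :
    HasDerivWithinAt (fun t => f (Function.update x j t))
      (partialDeriv j f (Function.update x j t)) (Icc 0 1) t := by
  have h1 := ((hf.differentiableOn (by simp)) _ (update_mem_cube hx j ht)).hasFDerivWithinAt
  exact h1.comp_hasDerivWithinAt t (hasDerivAt_update x j t).hasDerivWithinAt
    fun t' ht' => update_mem_cube hx j ht'

theorem restrict_cube (s : ℕ) : (volume : Measure (Fin s → ℝ)).restrict (cube s) =
    Measure.pi fun _ => (volume : Measure ℝ).restrict (Icc 0 1) := by
  rw [cube_eq_pi, volume_pi, Measure.restrict_pi_pi]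

/-- Fubini with the coordinate `j` integrated innermost, so a one-dimensional identity on every line
suffices. -/
theorem setIntegral_cube_congr {s : ℕ} (j : Fin s) {F G : (Fin s → ℝ) → ℂ}
    (hF : IntegrableOn F (cube s)) (hG : IntegrableOn G (cube s))
    (h : ∀ x ∈ cube s, ∫ t in (0 : ℝ)..1, F (Function.update x j t) =
      ∫ t in (0 : ℝ)..1, G (Function.update x j t)) :
    ∫ x in cube s, F x = ∫ x in cube s, G x := by
  obtain ⟨s, rfl⟩ : ∃ n, s = n + 1 := ⟨s - 1, by have := j.pos; omega⟩
  have mp := (measurePreserving_piFinSuccAbove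
    (fun _ : Fin (s + 1) => (volume : Measure ℝ).restrict (Icc 0 1)) j).symm
  have key : ∀ F : (Fin (s + 1) → ℝ) → ℂ, IntegrableOn F (cube (s + 1)) →
      ∫ x in cube (s + 1), F x = ∫ y in cube s, ∫ t in (0 : ℝ)..1, F (j.insertNth t y) := by
    intro F hF
    rw [IntegrableOn, restrict_cube] at hF
    have hi := (mp.integrable_comp_emb (MeasurableEquiv.measurableEmbedding _)).2 hF
    rw [restrict_cube, ← mp.integral_comp (MeasurableEquiv.measurableEmbedding _), restrict_cube,
      integral_prod_symm
        (fun z => F ((MeasurableEquiv.piFinSuccAbove (fun _ => ℝ) j).symm z)) hi]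
    refine integral_congr_ae (Eventually.of_forall fun y => ?_)
    simp only
    rw [intervalIntegral.integral_of_le zero_le_one, integral_Icc_eq_integral_Ioc]
    rfl
  rw [key F hF, key G hG]
  refine setIntegral_congr_fun (measurableSet_cube s) fun y hy => ?_
  have hx : (j.insertNth (0 : ℝ) y : Fin (s + 1) → ℝ) ∈ cube (s + 1) := by
    rw [cube_eq_pi] at hy ⊢
    intro i _
    induction i using j.succAboveCases with
    | x => simp
    | p i => simpa using hy i (mem_univ i)
  simpa only [Fin.update_insertNth] using h _ hx

theorem integrableOn_cube_mul {s : ℕ} {f : (Fin s → ℝ) → ℝ} (hf : ContinuousOn f (cube s))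
    {K : (Fin s → ℝ) → ℂ} (hK : Measurable K) {c : ℝ} (hc : ∀ x, ‖K x‖ ≤ c) :
    IntegrableOn (fun x => (f x : ℂ) * K x) (cube s) := by
  have h1 : IntegrableOn (fun x => (f x : ℂ)) (cube s) :=
    (Complex.continuous_ofReal.comp_continuousOn hf).integrableOn_compact isCompact_Icc
  exact h1.mul_bdd hK.aestronglyMeasurable (Eventually.of_forall hc)

/-- The product kernel with factors `ψ j` for `j ∈ l` and `φ j` otherwise. -/
def mixedKernel {s : ℕ} (φ ψ : Fin s → ℝ → ℂ) (l : List (Fin s)) (x : Fin s → ℝ) : ℂ :=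
  ∏ j, if j ∈ l then ψ j (x j) else φ j (x j)

theorem measurable_mixedKernel {s : ℕ} {φ ψ : Fin s → ℝ → ℂ} (hφ : ∀ j, Measurable (φ j))
    (hψ : ∀ j, Measurable (ψ j)) (l : List (Fin s)) : Measurable (mixedKernel φ ψ l) := by
  refine Finset.measurable_fun_prod _ fun j _ => ?_
  split_ifs
  · exact (hψ j).comp (measurable_pi_apply j)
  · exact (hφ j).comp (measurable_pi_apply j)

theorem exists_norm_mixedKernel_le {s : ℕ} {φ ψ : Fin s → ℝ → ℂ} {A C : Fin s → ℝ}
    (hA : ∀ j x, ‖φ j x‖ ≤ A j) (hC : ∀ j x, ‖ψ j x‖ ≤ C j) (l : List (Fin s)) (x : Fin s → ℝ) :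
    ‖mixedKernel φ ψ l x‖ ≤ ∏ j, if j ∈ l then C j else A j := by
  rw [mixedKernel, norm_prod]
  refine Finset.prod_le_prod (fun j _ => norm_nonneg _) fun j _ => ?_
  split_ifs
  · exact hC j _
  · exact hA j _

theorem mixedKernel_update {s : ℕ} (φ ψ : Fin s → ℝ → ℂ) (l : List (Fin s)) (x : Fin s → ℝ)
    (j : Fin s) (t : ℝ) : mixedKernel φ ψ l (Function.update x j t) =
      (if j ∈ l then ψ j t else φ j t) *
        ∏ i ∈ Finset.univ.erase j, if i ∈ l then ψ i (x i) else φ i (x i) := by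
  rw [mixedKernel, ← Finset.mul_prod_erase _ _ (Finset.mem_univ j)]
  congr 1
  · simp
  · refine Finset.prod_congr rfl fun i hi => ?_
    rw [Function.update_of_ne (Finset.ne_of_mem_erase hi)]

/-- The coordinates are treated one at a time, in the order in which `mixedDeriv` folds them. Along
a line in direction `j` the other kernel factors are constant, and the one-dimensional reduction
applies to the restriction of the current derivative. -/
theorem integral_cube_reduces {s : ℕ} {f : (Fin s → ℝ) → ℝ} (hf : ContDiffOn ℝ ∞ f (cube s))
    {φ ψ : Fin s → ℝ → ℂ} (hφ : ∀ j, Measurable (φ j)) (hψ : ∀ j, Measurable (ψ j))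
    {A C : Fin s → ℝ} (hA : ∀ j x, ‖φ j x‖ ≤ A j) (hC : ∀ j x, ‖ψ j x‖ ≤ C j) {α : Fin s → ℕ}
    (hr : ∀ j, ReducesTo (α j) (φ j) (ψ j)) (l : List (Fin s)) (hl : l.Nodup) :
    ContDiffOn ℝ ∞ (l.foldr (fun j g => (partialDeriv j)^[α j] g) f) (cube s) ∧
    ∫ x in cube s, (f x : ℂ) * mixedKernel φ ψ [] x =
      ∫ x in cube s, ((l.foldr (fun j g => (partialDeriv j)^[α j] g) f x : ℝ) : ℂ) *
        mixedKernel φ ψ l x := by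
  induction l with
  | nil => exact ⟨hf, rfl⟩
  | cons j l ih =>
    rw [List.nodup_cons] at hl
    obtain ⟨ih1, ih2⟩ := ih hl.2
    have hsm := contDiffOn_partialDeriv_iterate j (α j) ih1
    refine ⟨hsm, ih2.trans ?_⟩
    set F := l.foldr (fun j g => (partialDeriv j)^[α j] g) f with hF
    refine setIntegral_cube_congr j
      (integrableOn_cube_mul ih1.continuousOn (measurable_mixedKernel hφ hψ l)
        (exists_norm_mixedKernel_le hA hC l))
      (integrableOn_cube_mul hsm.continuousOn (measurable_mixedKernel hφ hψ (j :: l))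
        (exists_norm_mixedKernel_le hA hC (j :: l))) fun x hx => ?_
    have e : ∀ i ∈ Finset.univ.erase j, (if i ∈ j :: l then ψ i (x i) else φ i (x i)) =
        if i ∈ l then ψ i (x i) else φ i (x i) := by
      intro i hi
      simp [Finset.ne_of_mem_erase hi]
    simp_rw [List.foldr_cons, mixedKernel_update, if_neg hl.1, if_pos List.mem_cons_self]
    rw [Finset.prod_congr rfl e]
    simp_rw [← mul_assoc]
    rw [intervalIntegral.integral_mul_const, intervalIntegral.integral_mul_const]
    congr 1
    refine hr j (fun i t => (partialDeriv j)^[i] F (Function.update x j t)) (fun i t ht => ?_)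
      fun i t ht => ?_
    · exact (hasDerivWithinAt_update j (contDiffOn_partialDeriv_iterate j i ih1) hx
        ht).continuousWithinAt
    · have := hasDerivWithinAt_update j (contDiffOn_partialDeriv_iterate j i ih1) hx ht
      simp only [Function.iterate_succ_apply']
      exact this

theorem lintegral_mixedDeriv_le {s : ℕ} {u : ℕ → ℝ} (hu : ∀ j, 0 < u j) {f : (Fin s → ℝ) → ℝ}
    (hn : weightedNorm u f ≤ 1) (α : Fin s → ℕ) :
    ∫⁻ x in cube s, ‖mixedDeriv α f x‖ₑ ≤ ENNReal.ofReal (∏ j : Fin s, u j ^ α j) := by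
  have h1 := (le_iSup (fun α : Fin s → ℕ => (∫⁻ x in cube s, ‖mixedDeriv α f x‖ₑ) /
    ENNReal.ofReal (∏ j : Fin s, u j ^ α j)) α).trans hn
  have hpos : 0 < ∏ j : Fin s, u j ^ α j := Finset.prod_pos fun j _ => pow_pos (hu j) _
  rwa [ENNReal.div_le_iff (by simpa using hpos) ENNReal.ofReal_ne_top, one_mul] at h1

/-- After the reduction, the sup norm of the kernel multiplies the `L¹` norm of one mixed
derivative, which the weighted norm controls. -/
theorem norm_integral_cube_le {s : ℕ} {u : ℕ → ℝ} (hu : ∀ j, 0 < u j) {f : (Fin s → ℝ) → ℝ}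
    (hf : ContDiffOn ℝ ∞ f (cube s)) (hn : weightedNorm u f ≤ 1)
    {φ ψ : Fin s → ℝ → ℂ} (hφ : ∀ j, Measurable (φ j)) (hψ : ∀ j, Measurable (ψ j))
    {A C : Fin s → ℝ} (hA : ∀ j x, ‖φ j x‖ ≤ A j) (hC : ∀ j x, ‖ψ j x‖ ≤ C j) {α : Fin s → ℕ}
    (hr : ∀ j, ReducesTo (α j) (φ j) (ψ j)) :
    ‖∫ x in cube s, (f x : ℂ) * ∏ j, φ j (x j)‖ ≤ ∏ j : Fin s, C j * u j ^ α j := by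
  have hC0 : ∀ j, 0 ≤ C j := fun j => (norm_nonneg _).trans (hC j 0)
  have h := (integral_cube_reduces hf hφ hψ hA hC hr (List.finRange s) (List.nodup_finRange s)).2
  simp only [mixedKernel, List.not_mem_nil, if_false, List.mem_finRange, if_true] at h
  have hb : ∀ x : Fin s → ℝ, ‖∏ j, ψ j (x j)‖ ≤ ∏ j, C j := fun x => by
    rw [norm_prod]
    exact Finset.prod_le_prod (fun j _ => norm_nonneg _) fun j _ => hC j _
  have h0 : 0 ≤ (∏ j, C j) * ∏ j : Fin s, u j ^ α j :=
    mul_nonneg (Finset.prod_nonneg fun j _ => hC0 j)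
      (Finset.prod_nonneg fun j _ => pow_nonneg (hu j).le _)
  rw [h, Finset.prod_mul_distrib, ← ENNReal.ofReal_le_ofReal_iff h0, ofReal_norm]
  calc _ ≤ ∫⁻ x in cube s, ‖((mixedDeriv α f x : ℝ) : ℂ) * ∏ j, ψ j (x j)‖ₑ :=
        enorm_integral_le_lintegral_enorm _
    _ ≤ ∫⁻ x in cube s, ‖mixedDeriv α f x‖ₑ * ENNReal.ofReal (∏ j, C j) := by
        refine lintegral_mono fun x => ?_
        rw [enorm_mul]
        gcongr
        · rw [← ofReal_norm, Complex.norm_real, ofReal_norm]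
        · rw [← ofReal_norm]
          exact ENNReal.ofReal_le_ofReal (hb x)
    _ = (∫⁻ x in cube s, ‖mixedDeriv α f x‖ₑ) * ENNReal.ofReal (∏ j, C j) :=
        lintegral_mul_const' _ _ ENNReal.ofReal_ne_top
    _ ≤ _ := by
        rw [mul_comm, ENNReal.ofReal_mul (Finset.prod_nonneg fun j _ => hC0 j)]
        gcongr
        exact lintegral_mixedDeriv_le hu hn α

end InterlacedLattice

namespace InterlacedLattice

variable {b : ℕ} [hbp : Fact b.Prime]

/-! ### Walsh coefficients on the cube -/

open MeasureTheory Set Filter Topology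

theorem prod_range_mul {M : Type*} [CommMonoid M] (m d : ℕ) (F : ℕ → M) :
    ∏ l ∈ Finset.range (m * d), F l = ∏ h : Fin d, ∏ i : Fin m, F (d * i + h) := by
  rw [Finset.prod_range, ← finProdFinEquiv.prod_comp, Fintype.prod_prod_type_right]
  refine Finset.prod_congr rfl fun h _ => Finset.prod_congr rfl fun i _ => ?_
  rw [finProdFinEquiv_apply_val, add_comm]

theorem prod_fin_mul {M : Type*} [CommMonoid M] {s d : ℕ} (F : Fin (s * d) → M) :
    ∏ t, F t = ∏ j : Fin s, ∏ h : Fin d, F (finProdFinEquiv (j, h)) := by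
  rw [← finProdFinEquiv.prod_comp, Fintype.prod_prod_type]

/-- The index of the block that contains the component `t`. -/
def blockIndex {s d : ℕ} (t : Fin (s * d)) : Fin s := (finProdFinEquiv.symm t).1

theorem blockIndex_finProdFinEquiv {s d : ℕ} (j : Fin s) (h : Fin d) :
    blockIndex (finProdFinEquiv (j, h)) = j := by
  simp [blockIndex]

theorem finProdFinEquiv_mod {s d : ℕ} (j : Fin s) (h : Fin d) :
    ((finProdFinEquiv (j, h) : Fin (s * d)) : ℕ) % d = h := by
  rw [finProdFinEquiv_apply_val, Nat.add_mul_mod_self_left, Nat.mod_eq_of_lt h.isLt]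

theorem finProdFinEquiv_div {s d : ℕ} (j : Fin s) (h : Fin d) :
    ((finProdFinEquiv (j, h) : Fin (s * d)) : ℕ) / d = j := by
  rw [finProdFinEquiv_apply_val, Nat.add_mul_div_left _ _ h.pos, Nat.div_eq_of_lt h.isLt, zero_add]

/-- The Walsh function on the cube with the interlaced digit vectors `k`, conjugated. -/
def walshCube {s d m : ℕ} (k : Fin (s * d) → Fin m → ZMod b) (x : Fin s → ℝ) : ℂ :=
  ∏ t : Fin (s * d), ∏ i : Fin m, digitChar (-(k t i)) (d * i + t % d) (x (blockIndex t))

/-- The negated digits of the `j`-th coordinate of `k`. -/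
def coordDigits {s d m : ℕ} (k : Fin (s * d) → Fin m → ZMod b) (j : Fin s) (l : ℕ) : ZMod b :=
  if h : l < m * d then
    -k (finProdFinEquiv (j, (finProdFinEquiv.symm (⟨l, h⟩ : Fin (m * d))).2))
      (finProdFinEquiv.symm (⟨l, h⟩ : Fin (m * d))).1
  else 0

theorem coordDigits_apply {s d m : ℕ} (k : Fin (s * d) → Fin m → ZMod b) (j : Fin s) (h : Fin d)
    (i : Fin m) : coordDigits k j (d * i + h) = -k (finProdFinEquiv (j, h)) i := by
  have e : d * (i : ℕ) + h = (finProdFinEquiv (i, h) : Fin (m * d)) := by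
    rw [finProdFinEquiv_apply_val, add_comm]
  rw [coordDigits, dif_pos (e ▸ (finProdFinEquiv (i, h) : Fin (m * d)).isLt)]
  have e2 : (⟨d * (i : ℕ) + h, e ▸ (finProdFinEquiv (i, h) : Fin (m * d)).isLt⟩ : Fin (m * d)) =
      finProdFinEquiv (i, h) := Fin.ext e
  rw [e2, Equiv.symm_apply_apply]

theorem walshCube_eq_prod {s d m : ℕ} (k : Fin (s * d) → Fin m → ZMod b) (x : Fin s → ℝ) :
    walshCube k x = ∏ j, walsh (coordDigits k j) (m * d) (x j) := by
  rw [walshCube, prod_fin_mul]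
  refine Finset.prod_congr rfl fun j _ => ?_
  rw [walsh, prod_range_mul]
  refine Finset.prod_congr rfl fun h _ => Finset.prod_congr rfl fun i _ => ?_
  rw [coordDigits_apply, finProdFinEquiv_mod, blockIndex_finProdFinEquiv]

/-- The weight of a digit in the bound for the Walsh coefficients. -/
def coeffWeight (b d : ℕ) (u : ℕ → ℝ) (t i : ℕ) : ℝ := ((b : ℝ) ^ (d * i + t % d))⁻¹ * u (t / d)

/-- Coordinate `j` receives as many derivatives as it has nonzero digits, so the norm contributes
one factor `u j` for each of them. -/
theorem norm_walshCoeff_le {s d m : ℕ} {u : ℕ → ℝ} (hu : ∀ j, 0 < u j) {f : (Fin s → ℝ) → ℝ}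
    (hf : ContDiffOn ℝ ∞ f (cube s)) (hn : weightedNorm u f ≤ 1)
    (k : Fin (s * d) → Fin m → ZMod b) :
    ‖∫ x in cube s, (f x : ℂ) * walshCube k x‖ ≤
      supportWeight (fun t i => coeffWeight b d u t i) k := by
  choose ψ h1 h2 h3 using fun j => exists_reducesTo_walsh (coordDigits k j) (m * d)
  have := norm_integral_cube_le hu hf hn (fun j => measurable_walsh (coordDigits k j) (m * d)) h1
    (A := fun _ => 1) (fun j x => (norm_walsh _ _ x).le) h2 h3
  simp_rw [walshCube_eq_prod]
  refine this.trans (le_of_eq ?_)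
  rw [supportWeight, prod_fin_mul]
  refine Finset.prod_congr rfl fun j _ => ?_
  rw [← Finset.prod_pow_eq_pow_sum, ← Finset.prod_mul_distrib, prod_range_mul]
  refine Finset.prod_congr rfl fun h _ => Finset.prod_congr rfl fun i _ => ?_
  rw [coordDigits_apply, coeffWeight, finProdFinEquiv_mod, finProdFinEquiv_div]
  simp only [neg_eq_zero]
  split_ifs <;> simp

/-- Apply the reduction to the constant function 1: at least one derivative falls on it. -/
theorem integral_walsh_eq_zero (κ : ℕ → ZMod b) (M : ℕ) {l : ℕ} (hl : l < M) (hκ : κ l ≠ 0) :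
    ∫ t in (0 : ℝ)..1, walsh κ M t = 0 := by
  obtain ⟨ψ, -, -, h⟩ := exists_reducesTo_walsh κ M
  have h1 := h (fun i _ => if i = 0 then 1 else 0) (fun i => continuousOn_const) (fun i t _ => by
    simpa using hasDerivWithinAt_const t _ _)
  have h2 : ∑ l ∈ Finset.range M, (if κ l = 0 then 0 else 1) ≠ 0 := by
    intro h0
    have := Finset.sum_eq_zero_iff.1 h0 l (Finset.mem_range.2 hl)
    simp [hκ] at this
  rw [if_neg h2] at h1
  simpa using h1

theorem integral_walshCube {s d m : ℕ} (k : Fin (s * d) → Fin m → ZMod b) :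
    ∫ x in cube s, walshCube k x = if k = 0 then 1 else 0 := by
  simp_rw [walshCube_eq_prod]
  rw [restrict_cube, integral_fintype_prod_eq_prod]
  split_ifs with hk
  · refine Finset.prod_eq_one fun j _ => ?_
    have : ∀ x : ℝ, walsh (coordDigits k j) (m * d) x = 1 := fun x => by
      refine Finset.prod_eq_one fun l _ => ?_
      have : coordDigits k j l = 0 := by
        rw [coordDigits]; split_ifs <;> simp [hk]
      rw [this, digitChar, zero_mul, AddChar.map_zero_eq_one]
    simp [this]
  · obtain ⟨t, ht⟩ := Function.ne_iff.1 hk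
    obtain ⟨i, hi⟩ := Function.ne_iff.1 ht
    obtain ⟨⟨j, h⟩, rfl⟩ := finProdFinEquiv.surjective t
    refine Finset.prod_eq_zero (Finset.mem_univ j) ?_
    rw [integral_Icc_eq_integral_Ioc, ← intervalIntegral.integral_of_le zero_le_one]
    have e : d * (i : ℕ) + h = (finProdFinEquiv (i, h) : Fin (m * d)) := by
      rw [finProdFinEquiv_apply_val, add_comm]
    refine integral_walsh_eq_zero _ _ (l := d * i + h) (e ▸ Fin.isLt _) ?_
    rw [coordDigits_apply]
    simpa using hi

/-- The interlaced digits of a point of the cube. -/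
def cubeDigits (b : ℕ) {s d m : ℕ} (x : Fin s → ℝ) (t : Fin (s * d)) (i : Fin m) : ZMod b :=
  ((⌊x (blockIndex t) * (b : ℝ) ^ (d * (i : ℕ) + t % d + 1)⌋ : ℤ) : ZMod b)

/-- The character of the digit group that belongs to `k`. -/
def digitPairing {τ m : ℕ} (k z : Fin τ → Fin m → ZMod b) : ℂ :=
  ∏ t, ∏ i, ZMod.stdAddChar (k t i * z t i)

theorem digitPairing_mul_walshCube {s d m : ℕ} (k z : Fin (s * d) → Fin m → ZMod b)
    (x : Fin s → ℝ) :
    digitPairing k z * walshCube k x = digitPairing k (z - cubeDigits b x) := by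
  simp_rw [digitPairing, walshCube, ← Finset.prod_mul_distrib]
  refine Finset.prod_congr rfl fun t _ => Finset.prod_congr rfl fun i _ => ?_
  rw [digitChar, ← AddChar.map_add_eq_mul]
  congr 1
  simp only [cubeDigits, Pi.sub_apply]
  ring

theorem sum_digitPairing {τ m : ℕ} (y : Fin τ → Fin m → ZMod b) :
    ∑ k, digitPairing k y = if y = 0 then (((b : ℂ) ^ m) ^ τ) else 0 := by
  simp_rw [digitPairing]
  rw [sum_prod_prod (fun t i c => (ZMod.stdAddChar (c * y t i) : ℂ))]
  simp_rw [AddChar.sum_mulShift _ (ZMod.isPrimitive_stdAddChar b), ZMod.card]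
  split_ifs with hy
  · simp [hy]
  · obtain ⟨t, ht⟩ := Function.ne_iff.1 hy
    obtain ⟨i, hi⟩ := Function.ne_iff.1 ht
    refine Finset.prod_eq_zero (Finset.mem_univ t) (Finset.prod_eq_zero (Finset.mem_univ i) ?_)
    rw [if_neg (by simpa using hi)]; simp

theorem measurable_walshCube {s d m : ℕ} (k : Fin (s * d) → Fin m → ZMod b) :
    Measurable (walshCube k) :=
  Finset.measurable_fun_prod _ fun _ _ => Finset.measurable_fun_prod _ fun _ _ =>
    (measurable_digitChar _ _).comp (measurable_pi_apply _)

theorem norm_walshCube {s d m : ℕ} (k : Fin (s * d) → Fin m → ZMod b) (x : Fin s → ℝ) :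
    ‖walshCube k x‖ = 1 := by
  simp [walshCube, norm_digitChar]

/-- The sum over all `k` is a Walsh–Dirichlet kernel, a multiple of the indicator of the cell with
digits `z`. -/
theorem sum_walshCoeff {s d m : ℕ} {f : (Fin s → ℝ) → ℝ} (hf : ContinuousOn f (cube s))
    (z : Fin (s * d) → Fin m → ZMod b) :
    ∑ k, digitPairing k z * ∫ x in cube s, (f x : ℂ) * walshCube k x =
      ∫ x in cube s, (f x : ℂ) *
        if z - cubeDigits b x = 0 then (((b : ℂ) ^ m) ^ (s * d)) else 0 := by
  simp_rw [← sum_digitPairing, ← digitPairing_mul_walshCube, ← integral_const_mul, Finset.mul_sum]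
  rw [integral_finsetSum]
  · refine Finset.sum_congr rfl fun k _ => integral_congr_ae (Eventually.of_forall fun x => ?_)
    simp only; ring
  · intro k _
    refine integrableOn_cube_mul hf (measurable_const.mul (measurable_walshCube k))
      (c := ‖digitPairing k z‖) fun x => ?_
    rw [norm_mul, norm_walshCube, mul_one]

/-- For `f = 1` only `k = 0` has a nonzero coefficient; this normalizes the kernel without computing
the volume of the cell. -/
theorem integral_cell {s d m : ℕ} (z : Fin (s * d) → Fin m → ZMod b) :
    ∫ x in cube s, (if z - cubeDigits b x = 0 then (((b : ℂ) ^ m) ^ (s * d)) else 0) = 1 := by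
  have h := sum_walshCoeff (s := s) (f := fun _ => 1) continuousOn_const z
  simp only [Complex.ofReal_one, one_mul, integral_walshCube] at h
  rw [← h]
  simp [digitPairing, AddChar.map_zero_eq_one]

theorem measurableSet_cell {s d m : ℕ} (z : Fin (s * d) → Fin m → ZMod b) :
    MeasurableSet {x : Fin s → ℝ | z - cubeDigits b x = 0} := by
  have : {x : Fin s → ℝ | z - cubeDigits b x = 0} = ⋂ t : Fin (s * d), ⋂ i : Fin m,
      (fun x : Fin s → ℝ => ⌊x (blockIndex t) * (b : ℝ) ^ (d * (i : ℕ) + t % d + 1)⌋) ⁻¹'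
        {n : ℤ | z t i - ((n : ℤ) : ZMod b) = 0} := by
    ext x
    simp [funext_iff, cubeDigits]
  rw [this]
  refine MeasurableSet.iInter fun t => MeasurableSet.iInter fun i => ?_
  exact (Int.measurable_floor.comp ((measurable_pi_apply _).mul_const _)) trivial

/-- The partial Walsh sum at `z` is the mean of `f` over the cell of `z`, so it differs from `c` by
at most the largest deviation there. Faces `x j = 1` form a null set and are left out. -/
theorem norm_sum_walshCoeff_sub_le {s d m : ℕ} {f : (Fin s → ℝ) → ℝ}
    (hf : ContinuousOn f (cube s)) (z : Fin (s * d) → Fin m → ZMod b) (c : ℝ) {ε : ℝ}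
    (h : ∀ x ∈ cube s, (∀ j, x j < 1) → z = cubeDigits b x → |f x - c| ≤ ε) :
    ‖∑ k, digitPairing k z * (∫ x in cube s, (f x : ℂ) * walshCube k x) - c‖ ≤ ε := by
  set I : (Fin s → ℝ) → ℂ := fun x =>
    if z - cubeDigits b x = 0 then (((b : ℂ) ^ m) ^ (s * d)) else 0 with hI
  have hIm : Measurable I := Measurable.ite (measurableSet_cell z) measurable_const measurable_const
  have hIb : ∀ x, ‖I x‖ ≤ ((b : ℝ) ^ m) ^ (s * d) := by
    intro x
    rw [hI]; simp only
    split_ifs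
    · simp
    · rw [norm_zero]; positivity
  have hii : ∀ {g : (Fin s → ℝ) → ℝ}, ContinuousOn g (cube s) →
      IntegrableOn (fun x => (g x : ℂ) * I x) (cube s) := fun hg =>
    integrableOn_cube_mul hg hIm hIb
  have h1 : ∫ x in cube s, I x = 1 := integral_cell z
  have hnI : ∀ x, I x = ((‖I x‖ : ℝ) : ℂ) := by
    intro x
    rw [hI]; simp only
    split_ifs <;> simp
  have h1' : ∫ x in cube s, ‖I x‖ = 1 := by
    have : ∫ x in cube s, ((‖I x‖ : ℝ) : ℂ) = 1 := by
      rw [← h1]; exact integral_congr_ae (Eventually.of_forall fun x => (hnI x).symm)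
    rw [integral_complex_ofReal] at this
    exact_mod_cast this
  have hae : ∀ᵐ x ∂(volume : Measure (Fin s → ℝ)).restrict (cube s), x ∈ cube s ∧ ∀ j, x j < 1 := by
    have e : (Set.univ.pi fun _ : Fin s => Ico (0 : ℝ) 1) =ᵐ[volume] cube s :=
      Measure.univ_pi_Ico_ae_eq_Icc
    rw [← Measure.restrict_congr_set e]
    filter_upwards [ae_restrict_mem (MeasurableSet.univ_pi fun _ => measurableSet_Ico)] with x hx
    refine ⟨?_, fun j => (hx j (mem_univ j)).2⟩
    rw [cube_eq_pi]
    exact fun j _ => Ico_subset_Icc_self (hx j (mem_univ j))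
  rw [sum_walshCoeff hf]
  change ‖(∫ x in cube s, (f x : ℂ) * I x) - c‖ ≤ ε
  have hc : (c : ℂ) = ∫ x in cube s, (c : ℂ) * I x := by
    rw [integral_const_mul, h1, mul_one]
  rw [hc, ← integral_sub (hii hf) (hii (g := fun _ => c) continuousOn_const)]
  calc _ ≤ ∫ x in cube s, ε * ‖I x‖ := by
        refine norm_integral_le_of_norm_le ?_ ?_
        · have : IntegrableOn I (cube s) := by
            simpa using hii (g := fun _ => 1) continuousOn_const
          exact this.norm.const_mul ε
        · filter_upwards [hae] with x hx
          rw [← sub_mul, norm_mul]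
          by_cases hz : z - cubeDigits b x = 0
          · refine mul_le_mul_of_nonneg_right ?_ (norm_nonneg _)
            rw [← Complex.ofReal_sub, Complex.norm_real]
            exact h x hx.1 hx.2 (sub_eq_zero.1 hz)
          · have : I x = 0 := if_neg hz
            rw [this]; simp
    _ = ε := by rw [integral_const_mul, h1', mul_one]

end InterlacedLattice

namespace InterlacedLattice

variable {b : ℕ} [hbp : Fact b.Prime]

/-! ### The error of the quasi-Monte Carlo rule -/

open MeasureTheory Set Filter Topology

/-- The digits of a coordinate of the interlaced point. -/
def interlacedDigit (m : ℕ) {s d : ℕ} (hd : 0 < d) (q : Fin (s * d) → (ZMod b)[X])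
    (p : (ZMod b)[X]) (n : ℕ) (j : Fin s) (l : ℕ) : Fin b :=
  Real.digits (latticePoint b m q p n (finProdFinEquiv (j, ⟨l % d, Nat.mod_lt l hd⟩))) b (l / d)

theorem interlacedDigit_apply (m : ℕ) {s d : ℕ} (hd : 0 < d) (q : Fin (s * d) → (ZMod b)[X])
    (p : (ZMod b)[X]) (n : ℕ) (j : Fin s) (i : ℕ) (h : Fin d) :
    interlacedDigit m hd q p n j (d * i + h) =
      Real.digits (latticePoint b m q p n (finProdFinEquiv (j, h))) b i := by
  have e1 : (⟨(d * i + h) % d, Nat.mod_lt _ hd⟩ : Fin d) = h := by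
    apply Fin.ext
    simp only [Nat.mul_add_mod, Nat.mod_eq_of_lt h.isLt]
  have e2 : (d * i + h) / d = i := by
    rw [Nat.mul_add_div hd, Nat.div_eq_of_lt h.isLt, add_zero]
  rw [interlacedDigit, e1, e2]

theorem interlacedPoint_eq_sum {m s d M : ℕ} (hd : 0 < d) (hM : m ≤ M)
    (q : Fin (s * d) → (ZMod b)[X]) (p : (ZMod b)[X]) (n : ℕ) (j : Fin s) :
    interlacedPoint b m s d q p n j =
      ∑ l ∈ Finset.range (M * d), Real.ofDigitsTerm (interlacedDigit m hd q p n j) l := by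
  -- `Multiplicative ℝ` turns the reindexing of products into one of sums.
  have h1 := prod_range_mul (M := Multiplicative ℝ) M d
    (fun l => Multiplicative.ofAdd (Real.ofDigitsTerm (interlacedDigit m hd q p n j) l))
  change ∑ l ∈ Finset.range (M * d), Real.ofDigitsTerm (interlacedDigit m hd q p n j) l =
    ∑ h : Fin d, ∑ i : Fin M, Real.ofDigitsTerm (interlacedDigit m hd q p n j) (d * i + h) at h1
  rw [h1, interlacedPoint, interlace, tsum_eq_sum (s := Finset.range M)]
  · rw [Finset.sum_comm]
    refine Finset.sum_congr rfl fun h _ => ?_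
    rw [Finset.sum_range]
    refine Finset.sum_congr rfl fun i _ => ?_
    rw [Real.ofDigitsTerm, interlacedDigit_apply, div_eq_mul_inv, add_assoc]
  · intro i hi
    refine Finset.sum_eq_zero fun h _ => ?_
    rw [digits_latticePoint, latticeDigit, if_neg (by
      have := Finset.mem_range.not.1 hi; omega)]
    simp

theorem interlacedPoint_mem_cube {m s d : ℕ} (hd : 0 < d) (q : Fin (s * d) → (ZMod b)[X])
    (p : (ZMod b)[X]) (n : ℕ) : interlacedPoint b m s d q p n ∈ cube s := by
  rw [cube_eq_pi]
  intro j _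
  rw [interlacedPoint_eq_sum hd le_rfl]
  refine ⟨Finset.sum_nonneg fun l _ => Real.ofDigitsTerm_nonneg, ?_⟩
  refine le_trans ?_ (Real.ofDigits_le_one (interlacedDigit m hd q p n j))
  rw [Real.ofDigits_eq_sum_add_ofDigits _ (m * d)]
  have := Real.ofDigits_nonneg (fun i => interlacedDigit m hd q p n j (i + m * d))
  have hb : 0 < (b : ℝ) := cast_pos
  have : 0 ≤ ((b : ℝ) ^ (m * d))⁻¹ *
    Real.ofDigits (fun i => interlacedDigit m hd q p n j (i + m * d)) := by positivity
  linarith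

/-- Equality of the interlaced digits means that `x j` and the point share their first `M * d`
digits, after which the point has none. -/
theorem abs_sub_interlacedPoint_le {m s d M : ℕ} (hd : 0 < d) (hM : m ≤ M)
    (q : Fin (s * d) → (ZMod b)[X]) (p : (ZMod b)[X]) (n : ℕ) {x : Fin s → ℝ} (hx : x ∈ cube s)
    (hx1 : ∀ j, x j < 1)
    (h : (fun t (i : Fin M) => latticeDigit m q p n t i) = cubeDigits b x) (j : Fin s) :
    |x j - interlacedPoint b m s d q p n j| ≤ ((b : ℝ)⁻¹) ^ (M * d) := by
  rw [cube_eq_pi] at hx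
  have hx0 : 0 ≤ x j := (hx j (mem_univ j)).1
  have hxI : x j ∈ Ico (0 : ℝ) 1 := ⟨hx0, hx1 j⟩
  have e : interlacedPoint b m s d q p n j =
      ∑ l ∈ Finset.range (M * d), Real.ofDigitsTerm (Real.digits (x j) b) l := by
    rw [interlacedPoint_eq_sum hd hM]
    refine Finset.sum_congr rfl fun l hl => ?_
    obtain ⟨⟨i, h'⟩, hih⟩ := finProdFinEquiv.surjective
      (⟨l, Finset.mem_range.1 hl⟩ : Fin (M * d))
    have hl' : l = d * i + h' := by
      have := congrArg Fin.val hih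
      rw [finProdFinEquiv_apply_val] at this
      simpa [add_comm] using this.symm
    rw [Real.ofDigitsTerm, Real.ofDigitsTerm, hl', interlacedDigit_apply, digits_latticePoint]
    have h2 := congrFun (congrFun h (finProdFinEquiv (j, h'))) i
    simp only [cubeDigits, blockIndex_finProdFinEquiv, finProdFinEquiv_mod] at h2
    rw [h2, Real.digits, ← Int.natCast_floor_eq_floor (by positivity), Int.cast_natCast,
      ZMod.val_natCast, Fin.val_ofNat]
  have h1 := Real.le_sum_ofDigitsTerm_digits (b := b) hxI (M * d)
  have h2 := Real.sum_ofDigitsTerm_digits_le (b := b) hxI (M * d)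
  rw [e, abs_le]
  constructor <;> linarith [pow_nonneg (inv_nonneg.2 (cast_pos (b := b)).le) (M * d)]

/-- The lattice points have no digits from index `m` on, so only the first `m` digits of each row of
`k` decide duality. -/
theorem sum_digitPairing_latticeDigit {τ m m₂ : ℕ} {p : (ZMod b)[X]} (hp : p ≠ 0)
    (hm : p.natDegree = m) (q : Fin τ → (ZMod b)[X]) (k : Fin τ → Fin (m + m₂) → ZMod b)
    [Decidable (IsDual p q fun t i => k t (Fin.castAdd m₂ i))] :
    ∑ n ∈ Finset.range (b ^ m), digitPairing k (fun t i => latticeDigit m q p n t i) =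
      if IsDual p q (fun t i => k t (Fin.castAdd m₂ i)) then (b : ℂ) ^ m else 0 := by
  classical
  convert! sum_stdAddChar_quotCoeff hp hm q (fun t i => k t (Fin.castAdd m₂ i)) using 2 with n hn
  rw [stdAddChar_sum, digitPairing]
  refine Finset.prod_congr rfl fun t _ => ?_
  rw [stdAddChar_sum, Fin.prod_univ_add]
  have h2 : ∏ i : Fin m₂, (ZMod.stdAddChar (k t (Fin.natAdd m i) *
      latticeDigit m q p n t (Fin.natAdd m i)) : ℂ) = 1 := by
    refine Finset.prod_eq_one fun i _ => ?_
    rw [latticeDigit, if_neg (by simp), mul_zero, AddChar.map_zero_eq_one]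
  rw [h2, mul_one]
  refine Finset.prod_congr rfl fun i _ => ?_
  rw [latticeDigit, Fin.val_castAdd, if_pos i.isLt]

open scoped Classical in
theorem abs_qmc_sub_integral_le {m s d : ℕ} (hd : 0 < d) {u : ℕ → ℝ} (hu : ∀ j, 0 < u j)
    {p : (ZMod b)[X]} (hp : p ≠ 0) (hm : p.natDegree = m) (q : Fin (s * d) → (ZMod b)[X])
    {f : (Fin s → ℝ) → ℝ} (hf : ContDiffOn ℝ ∞ f (cube s)) (hn : weightedNorm u f ≤ 1)
    {ε : ℝ} (hε : 0 < ε) : ∃ m₂ : ℕ,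
      |qmc (b ^ m) (interlacedPoint b m s d q p) f - ∫ x in cube s, f x| ≤
        ε + ∑ k : Fin (s * d) → Fin (m + m₂) → ZMod b,
          if k ≠ 0 ∧ IsDual p q (fun t i => k t (Fin.castAdd m₂ i)) then
            supportWeight (fun t i => coeffWeight b d u t i) k else 0 := by
  have hb0 : (0 : ℝ) < b := cast_pos
  have hb0' : (b : ℂ) ≠ 0 := by exact_mod_cast hbp.out.ne_zero
  have huc := isCompact_Icc.uniformContinuousOn_of_continuous
    (show ContinuousOn f (Icc (0 : Fin s → ℝ) 1) from hf.continuousOn)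
  obtain ⟨δ, hδ, hδ'⟩ := Metric.uniformContinuousOn_iff.1 huc ε hε
  -- Enough extra digits make the cells finer than the modulus of continuity `δ` of `f` for `ε`.
  obtain ⟨m₂, hm₂⟩ := exists_pow_lt_of_lt_one hδ
    (inv_lt_one_of_one_lt₀ (show (1 : ℝ) < b by exact_mod_cast hbp.out.one_lt))
  refine ⟨m₂, ?_⟩
  set M := m + m₂ with hM
  have hpow : ((b : ℝ)⁻¹) ^ (M * d) < δ := by
    refine lt_of_le_of_lt ?_ hm₂
    refine pow_le_pow_of_le_one (inv_nonneg.2 hb0.le)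
      (inv_le_one_of_one_le₀ (by exact_mod_cast hbp.out.one_le)) ?_
    calc m₂ ≤ M := by omega
      _ ≤ M * d := Nat.le_mul_of_pos_right _ hd
  set z : ℕ → Fin (s * d) → Fin M → ZMod b := fun n t i => latticeDigit m q p n t i with hz
  set c : (Fin (s * d) → Fin M → ZMod b) → ℂ := fun k =>
    ∫ x in cube s, (f x : ℂ) * walshCube k x with hc
  set y := interlacedPoint b m s d q p with hy
  have hpt : ∀ n, ‖∑ k, digitPairing k (z n) * c k - f (y n)‖ ≤ ε := by
    intro n
    refine norm_sum_walshCoeff_sub_le hf.continuousOn (z n) (f (y n)) fun x hx hx1 hxz => ?_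
    refine (hδ' x hx (y n) (interlacedPoint_mem_cube hd q p n) ?_).le
    rw [dist_pi_lt_iff hδ]
    intro j
    rw [Real.dist_eq]
    exact (abs_sub_interlacedPoint_le hd (by omega) q p n hx hx1 hxz j).trans_lt hpow
  have hc0 : c 0 = ((∫ x in cube s, f x : ℝ) : ℂ) := by
    rw [hc, ← integral_complex_ofReal]
    simp [walshCube, digitChar, AddChar.map_zero_eq_one]
  have havg : (∑ n ∈ Finset.range (b ^ m), ∑ k, digitPairing k (z n) * c k) / (b : ℂ) ^ m =
      ∑ k, if IsDual p q (fun t i => k t (Fin.castAdd m₂ i)) then c k else 0 := by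
    rw [Finset.sum_comm, Finset.sum_div]
    refine Finset.sum_congr rfl fun k _ => ?_
    rw [← Finset.sum_mul, sum_digitPairing_latticeDigit hp hm]
    split_ifs
    · rw [mul_div_right_comm, div_self (pow_ne_zero _ hb0'), one_mul]
    · simp
  have hdual0 : IsDual p q (fun t i => (0 : Fin (s * d) → Fin M → ZMod b) t (Fin.castAdd m₂ i)) := by
    have : (fun (t : Fin (s * d)) (i : Fin m) =>
        (0 : Fin (s * d) → Fin M → ZMod b) t (Fin.castAdd m₂ i)) = 0 := rfl
    rw [this]
    simp [IsDual, coeffPoly_zero]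
  have hsplit : (∑ k, if IsDual p q (fun t i => k t (Fin.castAdd m₂ i)) then c k else 0) =
      c 0 + ∑ k, if k ≠ 0 ∧ IsDual p q (fun t i => k t (Fin.castAdd m₂ i)) then c k else 0 := by
    rw [← Finset.add_sum_erase _ _ (Finset.mem_univ 0), if_pos hdual0,
      ← Finset.add_sum_erase (a := 0) (f := fun k => if k ≠ 0 ∧
        IsDual p q (fun t i => k t (Fin.castAdd m₂ i)) then c k else 0) _ (Finset.mem_univ 0)]
    simp only [ne_eq, not_true_eq_false, false_and, if_false, zero_add]
    congr 1
    refine Finset.sum_congr rfl fun k hk => ?_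
    simp [Finset.ne_of_mem_erase hk]
  have hq : ((qmc (b ^ m) y f - ∫ x in cube s, f x : ℝ) : ℂ) =
      -((∑ n ∈ Finset.range (b ^ m), (∑ k, digitPairing k (z n) * c k - f (y n))) / (b : ℂ) ^ m) +
        ∑ k, if k ≠ 0 ∧ IsDual p q (fun t i => k t (Fin.castAdd m₂ i)) then c k else 0 := by
    rw [Finset.sum_sub_distrib, sub_div, havg, hsplit, hc0, qmc]
    push_cast
    ring
  have hR : |qmc (b ^ m) y f - ∫ x in cube s, f x| =
      ‖((qmc (b ^ m) y f - ∫ x in cube s, f x : ℝ) : ℂ)‖ := by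
    rw [Complex.norm_real, Real.norm_eq_abs]
  rw [hR, hq]
  refine (norm_add_le _ _).trans (add_le_add ?_ ?_)
  · rw [norm_neg, norm_div, norm_pow, Complex.norm_natCast, div_le_iff₀ (by positivity)]
    refine (norm_sum_le _ _).trans ((Finset.sum_le_sum fun n _ => hpt n).trans (le_of_eq ?_))
    rw [Finset.sum_const, Finset.card_range, nsmul_eq_mul]
    push_cast; ring
  · refine (norm_sum_le _ _).trans (Finset.sum_le_sum fun k _ => ?_)
    split_ifs
    · exact norm_walshCoeff_le hu hf hn k
    · simp

end InterlacedLattice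

namespace InterlacedLattice

variable {b : ℕ} [hbp : Fact b.Prime]

/-! ### The dual sum of the Walsh coefficients in terms of the criterion -/

theorem supportWeight_mul {τ m : ℕ} (w w' : Fin τ → Fin m → ℝ) (k : Fin τ → Fin m → ZMod b) :
    supportWeight w k * supportWeight w' k = supportWeight (fun t i => w t i * w' t i) k := by
  simp_rw [supportWeight, ← Finset.prod_mul_distrib]
  refine Finset.prod_congr rfl fun t _ => Finset.prod_congr rfl fun i _ => ?_
  split_ifs <;> simp

theorem supportWeight_le_dualSum_sub_one {τ m : ℕ} {w : ℕ → ℕ → ℝ} (hw : ∀ t i, 0 ≤ w t i)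
    {p : (ZMod b)[X]} {q : Fin τ → (ZMod b)[X]} {k : Fin τ → Fin m → ZMod b} (hk : k ≠ 0)
    (hd : IsDual p q k) : supportWeight (fun t i => w t i) k ≤ dualSum m w p q - 1 := by
  classical
  have h0 : IsDual p q (0 : Fin τ → Fin m → ZMod b) := by simp [IsDual, coeffPoly_zero]
  have hn : ∀ k : Fin τ → Fin m → ZMod b,
      0 ≤ if IsDual p q k then supportWeight (fun t i => w t i) k else 0 := fun k => by
    split_ifs
    · exact supportWeight_nonneg (fun t i => hw t i) k
    · exact le_rfl
  rw [dualSum, ← Finset.add_sum_erase _ _ (Finset.mem_univ 0), if_pos h0, supportWeight_zero,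
    add_sub_cancel_left]
  have := Finset.single_le_sum (f := fun k : Fin τ → Fin m → ZMod b =>
    if IsDual p q k then supportWeight (fun t i => w t i) k else 0) (fun k _ => hn k)
    (Finset.mem_erase.2 ⟨hk, Finset.mem_univ k⟩)
  simpa [hd] using this

theorem supportWeight_le_prod {τ m : ℕ} {w : Fin τ → Fin m → ℝ} (hw : ∀ t i, 0 ≤ w t i)
    (k : Fin τ → Fin m → ZMod b) : supportWeight w k ≤ ∏ t, ∏ i, (1 + w t i) := by
  have h : ∀ t i, 0 ≤ if k t i = 0 then 1 else w t i := fun t i => by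
    split_ifs <;> [exact zero_le_one; exact hw t i]
  refine Finset.prod_le_prod (fun t _ => Finset.prod_nonneg fun i _ => h t i) fun t _ =>
    Finset.prod_le_prod (fun i _ => h t i) fun i _ => ?_
  split_ifs <;> linarith [hw t i]

theorem supportWeight_le_mul_prod {τ m : ℕ} {w : Fin τ → Fin m → ℝ} (hw : ∀ t i, 0 ≤ w t i)
    {k : Fin τ → Fin m → ZMod b} {t₀ : Fin τ} {i₀ : Fin m} (hk : k t₀ i₀ ≠ 0) {Y : ℝ}
    (hY : w t₀ i₀ ≤ Y) : supportWeight w k ≤ Y * ∏ t, ∏ i, (1 + w t i) := by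
  have h : ∀ t i, 0 ≤ if k t i = 0 then 1 else w t i := fun t i => by
    split_ifs <;> [exact zero_le_one; exact hw t i]
  have hY0 := (hw t₀ i₀).trans hY
  -- `Y` is spread over the index set so that the two products can be compared factor by factor.
  have e : Y = ∏ x : Fin τ × Fin m, if x = (t₀, i₀) then Y else 1 := by
    rw [Finset.prod_ite_eq', if_pos (Finset.mem_univ _)]
  rw [supportWeight]
  simp_rw [← Fintype.prod_prod_type']
  conv_rhs => rw [e]
  rw [← Finset.prod_mul_distrib]
  refine Finset.prod_le_prod (fun x _ => h x.1 x.2) fun x _ => ?_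
  have := hw x.1 x.2
  by_cases hx : x = (t₀, i₀)
  · subst hx
    rw [if_pos rfl, if_neg hk]
    nlinarith
  · rw [if_neg hx]
    split_ifs <;> linarith

/-- Cut the digits at `m`. If the lower part is nonzero, it is a nonzero dual vector and its weight
is one term of `dualSum - 1`. Otherwise some digit has index at least `m` and contributes at most
`Y`. All remaining factors fit in the product of `1 + w`. -/
theorem supportWeight_le_of_isDual {τ m m₂ : ℕ} {w : ℕ → ℕ → ℝ} (hw : ∀ t i, 0 ≤ w t i)
    {p : (ZMod b)[X]} {q : Fin τ → (ZMod b)[X]} {k : Fin τ → Fin (m + m₂) → ZMod b} (hk : k ≠ 0)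
    (hd : IsDual p q fun t i => k t (Fin.castAdd m₂ i)) {Y : ℝ} (hY0 : 0 ≤ Y)
    (hY : ∀ t < τ, ∀ i, m ≤ i → w t i ≤ Y) :
    supportWeight (fun t i => w t i) k ≤
      (dualSum m w p q - 1 + Y) * ∏ t : Fin τ, ∏ i : Fin (m + m₂), (1 + w t i) := by
  have hΛ : 0 ≤ ∏ t : Fin τ, ∏ i : Fin (m + m₂), (1 + w t i) :=
    Finset.prod_nonneg fun t _ => Finset.prod_nonneg fun i _ => by linarith [hw t i]
  have hB := one_le_dualSum (m := m) hw p q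
  by_cases hl : (fun t i => k t (Fin.castAdd m₂ i)) = 0
  · obtain ⟨t, ht⟩ := Function.ne_iff.1 hk
    obtain ⟨i, hi⟩ := Function.ne_iff.1 ht
    have him : m ≤ (i : ℕ) := by
      by_contra hlt
      exact hi (congrFun (congrFun hl t) ⟨i, not_le.1 hlt⟩)
    refine (supportWeight_le_mul_prod (fun t i => hw t i) hi (hY t t.isLt i him)).trans ?_
    exact mul_le_mul_of_nonneg_right (by linarith) hΛ
  · have h1 := supportWeight_le_dualSum_sub_one hw hl hd
    have e : supportWeight (fun t i => w t i) k =
        supportWeight (fun t i => w t i) (fun t i => k t (Fin.castAdd m₂ i)) *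
        supportWeight (fun t i => w t (m + i)) (fun t i => k t (Fin.natAdd m i)) := by
      simp_rw [supportWeight, ← Finset.prod_mul_distrib, Fin.prod_univ_add, Fin.val_castAdd,
        Fin.val_natAdd]
    have h2 : supportWeight (fun t i => w t (m + i)) (fun t i => k t (Fin.natAdd m i)) ≤
        ∏ t : Fin τ, ∏ i : Fin (m + m₂), (1 + w t i) := by
      refine (supportWeight_le_prod (fun t i => hw _ _) _).trans ?_
      refine Finset.prod_le_prod (fun t _ => Finset.prod_nonneg fun i _ => by linarith [hw t (m + i)])
        fun t _ => ?_
      rw [Fin.prod_univ_add]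
      refine le_mul_of_one_le_left (Finset.prod_nonneg fun i _ => by linarith [hw t (m + i)]) ?_
      calc (1 : ℝ) = ∏ i : Fin m, 1 := by simp
        _ ≤ _ := Finset.prod_le_prod (fun i _ => zero_le_one) fun i _ => by
          linarith [hw t (Fin.castAdd m₂ i)]
    rw [e]
    refine mul_le_mul (by linarith) h2 (supportWeight_nonneg (fun t i => hw _ _) _) (by linarith)

open scoped Classical in
-- The factor `K` occurs once per nonzero digit, so it cannot be pulled out as a constant. One
-- square root of the weight is bounded uniformly over the dual vectors; the other carries `K` and
-- is summed over all `k`.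
theorem sum_isDual_le {τ m m₂ : ℕ} {w : ℕ → ℕ → ℝ} (hw : ∀ t i, 0 ≤ w t i)
    (p : (ZMod b)[X]) (q : Fin τ → (ZMod b)[X]) {Y K : ℝ} (hY0 : 0 ≤ Y) (hK : 0 ≤ K)
    (hY : ∀ t < τ, ∀ i, m ≤ i → w t i ≤ Y) :
    ∑ k : Fin τ → Fin (m + m₂) → ZMod b,
      (if k ≠ 0 ∧ IsDual p q (fun t i => k t (Fin.castAdd m₂ i)) then
        supportWeight (fun t i => K * w t i) k else 0) ≤
      ((dualSum m w p q - 1 + Y) * ∏ t : Fin τ, ∏ i : Fin (m + m₂), (1 + w t i)) ^ (1 / 2 : ℝ) *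
        ∏ t : Fin τ, ∏ i : Fin (m + m₂), (1 + (b - 1) * (K * w t i ^ (1 / 2 : ℝ))) := by
  rw [← sum_supportWeight, Finset.mul_sum]
  have hwr : ∀ t i, 0 ≤ w t i ^ (1 / 2 : ℝ) := fun t i => Real.rpow_nonneg (hw t i) _
  have hB := one_le_dualSum (m := m) hw p q
  refine Finset.sum_le_sum fun k _ => ?_
  have hn : 0 ≤ supportWeight (fun t i => K * w t i ^ (1 / 2 : ℝ)) k :=
    supportWeight_nonneg (fun t i => mul_nonneg hK (hwr t i)) k
  split_ifs with h
  · have e : supportWeight (fun t i => K * w t i) k =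
        supportWeight (fun t i => w t i) k ^ (1 / 2 : ℝ) *
          supportWeight (fun t i => K * w t i ^ (1 / 2 : ℝ)) k := by
      rw [supportWeight_rpow (fun t i => hw t i), supportWeight_mul]
      congr 1
      funext t i
      rw [mul_left_comm, ← Real.sqrt_eq_rpow, Real.mul_self_sqrt (hw t i)]
    rw [e]
    refine mul_le_mul_of_nonneg_right (Real.rpow_le_rpow ?_ ?_ (by norm_num)) hn
    · exact supportWeight_nonneg (fun t i => hw t i) k
    · exact supportWeight_le_of_isDual hw h.1 h.2 hY0 hY
  · refine mul_nonneg (Real.rpow_nonneg (mul_nonneg (by linarith) ?_) _) hn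
    exact Finset.prod_nonneg fun t _ => Finset.prod_nonneg fun i _ => by linarith [hw t i]

theorem prod_one_add_le_exp {τ m : ℕ} {w : Fin τ → Fin m → ℝ} (hw : ∀ t i, 0 ≤ w t i) :
    ∏ t, ∏ i, (1 + w t i) ≤ Real.exp (∑ t, ∑ i, w t i) := by
  simp_rw [Real.exp_sum]
  refine Finset.prod_le_prod (fun t _ => Finset.prod_nonneg fun i _ => by linarith [hw t i])
    fun t _ => Finset.prod_le_prod (fun i _ => by linarith [hw t i]) fun i _ => ?_
  linarith [Real.add_one_le_exp (w t i)]

end InterlacedLattice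

namespace InterlacedLattice

variable {b : ℕ} [hbp : Fact b.Prime]

/-! ### Sums of the digit weights -/

theorem minConst_pos : 0 < minConst b := by
  have hb : (2 : ℝ) ≤ b := by exact_mod_cast hbp.out.two_le
  refine mul_pos two_pos (Real.sin_pos_of_pos_of_lt_pi (by positivity) ?_)
  rw [div_lt_iff₀ (by linarith)]
  nlinarith [Real.pi_pos]

theorem walshConst_pos : 0 < walshConst b := by
  unfold walshConst
  split_ifs with h
  · exact two_pos
  · have hb : (3 : ℝ) ≤ b := by
      have := hbp.out.two_le
      exact_mod_cast (show 3 ≤ b by omega)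
    have h1 : 0 ≤ maxConst b ∧ maxConst b ≤ 2 := by
      unfold maxConst
      split_ifs
      · norm_num
      · have h0 : 0 ≤ Real.sin ((b + 1) * Real.pi / (2 * b)) := by
          refine Real.sin_nonneg_of_nonneg_of_le_pi (by positivity) ?_
          rw [div_le_iff₀ (by linarith)]
          nlinarith [Real.pi_pos]
        have := Real.sin_le_one ((b + 1) * Real.pi / (2 * b))
        constructor <;> linarith
    have h2 : 0 < b * minConst b / (b - maxConst b) :=
      div_pos (mul_pos (by linarith) minConst_pos) (by linarith [h1.2])
    linarith [h1.1]

theorem digitWeight_eq {d : ℕ} {u : ℕ → ℝ} (hu : ∀ j, 0 < u j) (t i : ℕ) :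
    digitWeight b d u t i = ((b : ℝ) ^ (d * i + t % d + 1))⁻¹ *
      (walshConst b * (minConst b)⁻¹ * u (t / d)) := by
  have hb : (0 : ℝ) < b := by exact_mod_cast hbp.out.pos
  have hb1 : (b : ℝ) ≠ 1 := by exact_mod_cast hbp.out.one_lt.ne'
  have hc : 0 < walshConst b * (minConst b)⁻¹ * u (t / d) :=
    mul_pos (mul_pos walshConst_pos (inv_pos.2 minConst_pos)) (hu _)
  rw [digitWeight, Real.rpow_add hb, Real.rpow_natCast, mul_inv, ← Real.rpow_neg hb.le, expo,
    neg_neg, Real.rpow_logb hb hb1 hc]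
  rfl

theorem coeffWeight_eq {d : ℕ} {u : ℕ → ℝ} (hu : ∀ j, 0 < u j) (t i : ℕ) :
    coeffWeight b d u t i = b * (walshConst b * (minConst b)⁻¹)⁻¹ * digitWeight b d u t i := by
  have hb : (b : ℝ) ≠ 0 := cast_pos.ne'
  have h1 := (walshConst_pos (b := b)).ne'
  have h2 := (minConst_pos (b := b)).ne'
  rw [digitWeight_eq hu, coeffWeight, pow_succ]
  field_simp

/-- The lower limit gives the decay from some `J` on; monotonicity and the constant `A` take care of
the finitely many earlier weights. -/
theorem exists_decay {u : ℕ → ℝ} (hu_pos : ∀ j, 0 < u j) (hu_anti : Antitone u) {r : ℝ}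
    (hr : 0 < r) (hu : 0 < Filter.liminf
      (fun j : ℕ => ((Real.log (u j)⁻¹ / ((j : ℝ) + 1) ^ r : ℝ) : EReal)) Filter.atTop) :
    ∃ c A : ℝ, 0 < c ∧ 0 < A ∧ ∀ j : ℕ, u j ≤ A * Real.exp (-(c * ((j : ℝ) + 1) ^ r)) := by
  obtain ⟨c, hc0, hc⟩ := EReal.lt_iff_exists_real_btwn.1 hu
  have hc0' : 0 < c := by exact_mod_cast hc0
  obtain ⟨J, hJ⟩ := Filter.eventually_atTop.1 (Filter.eventually_lt_of_lt_liminf hc)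
  refine ⟨c, max 1 (u 0 * Real.exp (c * ((J : ℝ) + 1) ^ r)), hc0', by positivity, fun j => ?_⟩
  rcases le_or_gt J j with h | h
  · have h1 : c < Real.log (u j)⁻¹ / ((j : ℝ) + 1) ^ r := by exact_mod_cast hJ j h
    have h2 : u j ≤ Real.exp (-(c * ((j : ℝ) + 1) ^ r)) := by
      rw [← Real.log_le_iff_le_exp (hu_pos j)]
      rw [lt_div_iff₀ (by positivity), Real.log_inv] at h1
      linarith
    exact h2.trans (le_mul_of_one_le_left (Real.exp_pos _).le (le_max_left _ _))
  · have h3 : ((j : ℝ) + 1) ^ r ≤ ((J : ℝ) + 1) ^ r := by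
      refine Real.rpow_le_rpow (by positivity) ?_ hr.le
      have : (j : ℝ) ≤ J := by exact_mod_cast h.le
      linarith
    calc u j ≤ u 0 := hu_anti (Nat.zero_le j)
      _ = u 0 * Real.exp (c * ((J : ℝ) + 1) ^ r) * Real.exp (-(c * ((J : ℝ) + 1) ^ r)) := by
        rw [mul_assoc, ← Real.exp_add, add_neg_cancel, Real.exp_zero, mul_one]
      _ ≤ _ := by
        refine mul_le_mul (le_max_right _ _) ?_ (Real.exp_pos _).le (by positivity)
        rw [Real.exp_le_exp]
        have := mul_le_mul_of_nonneg_left h3 hc0'.le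
        linarith

theorem exp_neg_le {y p : ℝ} (hy : 0 < y) (hp : 0 < p) : Real.exp (-y) ≤ p ^ p * y ^ (-p) := by
  have h1 : y / p ≤ Real.exp (y / p) := by linarith [Real.add_one_le_exp (y / p)]
  have h2 := Real.rpow_le_rpow (by positivity) h1 hp.le
  rw [← Real.exp_mul, div_mul_cancel₀ _ hp.ne', Real.div_rpow hy.le hp.le,
    div_le_iff₀ (by positivity)] at h2
  rw [Real.exp_neg, Real.rpow_neg hy.le, ← div_eq_mul_inv, inv_eq_one_div,
    div_le_div_iff₀ (Real.exp_pos _) (by positivity)]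
  linarith

/-- The full series equals `1 / (b^l - 1)`, and `b^l - 1 ≥ l log b`. -/
theorem sum_geometric_le {l : ℝ} (hl : 0 < l) (L : ℕ) :
    ∑ n ∈ Finset.range L, (((b : ℝ) ^ (n + 1))⁻¹) ^ l ≤ (l * Real.log b)⁻¹ := by
  have hb : (0 : ℝ) < b := cast_pos
  have hlog : 0 < Real.log b := Real.log_pos (by exact_mod_cast hbp.out.one_lt)
  set ρ := (b : ℝ) ^ (-l) with hρ
  have hρ0 : 0 < ρ := Real.rpow_pos_of_pos hb _
  have hρe : ρ = Real.exp (-(l * Real.log b)) := by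
    rw [hρ, Real.rpow_def_of_pos hb]; congr 1; ring
  have hρ1 : ρ < 1 := by
    rw [hρe, Real.exp_lt_one_iff]; nlinarith
  have e : ∀ n : ℕ, (((b : ℝ) ^ (n + 1))⁻¹) ^ l = ρ * ρ ^ n := by
    intro n
    rw [← pow_succ', ← inv_pow, ← Real.rpow_natCast, ← Real.rpow_mul (by positivity), mul_comm,
      Real.rpow_mul (by positivity), Real.rpow_natCast, Real.inv_rpow hb.le, hρ, Real.rpow_neg hb.le]
  simp_rw [e, ← Finset.mul_sum]
  have h1 : ∑ n ∈ Finset.range L, ρ ^ n ≤ (1 - ρ)⁻¹ := by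
    rw [← tsum_geometric_of_lt_one hρ0.le hρ1]
    exact (summable_geometric_of_lt_one hρ0.le hρ1).sum_le_tsum _ fun n _ => by positivity
  refine (mul_le_mul_of_nonneg_left h1 hρ0.le).trans ?_
  rw [← div_eq_mul_inv, div_le_iff₀ (by linarith), inv_mul_eq_div, le_div_iff₀ (by positivity)]
  have h2 := Real.add_one_le_exp (l * Real.log b)
  have h3 : ρ * Real.exp (l * Real.log b) = 1 := by
    rw [hρe, ← Real.exp_add, neg_add_cancel, Real.exp_zero]
  nlinarith

/-- Within a block the exponents `d * i + h + 1` run through `1, …, M * d` once each, which is why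
the bounds are uniform in `d`. -/
theorem sum_fin_mul_digitWeight {s d M : ℕ} {u : ℕ → ℝ} (hu : ∀ j, 0 < u j) (l : ℝ) :
    ∑ t : Fin (s * d), ∑ i : Fin M, digitWeight b d u t i ^ l =
      ∑ j : Fin s, (walshConst b * (minConst b)⁻¹ * u j) ^ l *
        ∑ n ∈ Finset.range (M * d), (((b : ℝ) ^ (n + 1))⁻¹) ^ l := by
  have hc : 0 < walshConst b * (minConst b)⁻¹ := mul_pos walshConst_pos (inv_pos.2 minConst_pos)
  have hb : (0 : ℝ) < b := cast_pos
  have h1 : ∑ t : Fin (s * d), ∑ i : Fin M, digitWeight b d u t i ^ l =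
      ∑ j : Fin s, ∑ h : Fin d, ∑ i : Fin M,
        digitWeight b d u (finProdFinEquiv (j, h) : Fin (s * d)) i ^ l :=
    prod_fin_mul (M := Multiplicative ℝ)
      (fun t : Fin (s * d) => Multiplicative.ofAdd (∑ i : Fin M, digitWeight b d u t i ^ l))
  have h2 : ∑ n ∈ Finset.range (M * d), (((b : ℝ) ^ (n + 1))⁻¹) ^ l =
      ∑ h : Fin d, ∑ i : Fin M, (((b : ℝ) ^ (d * i + h + 1))⁻¹) ^ l :=
    prod_range_mul (M := Multiplicative ℝ) M d
      (fun n => Multiplicative.ofAdd ((((b : ℝ) ^ (n + 1))⁻¹) ^ l))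
  rw [h1, h2]
  simp_rw [Finset.mul_sum]
  refine Finset.sum_congr rfl fun j _ => Finset.sum_congr rfl fun h _ =>
    Finset.sum_congr rfl fun i _ => ?_
  rw [digitWeight_eq hu, finProdFinEquiv_mod, finProdFinEquiv_div,
    Real.mul_rpow (by positivity) (mul_pos hc (hu _)).le, mul_comm]

/-- As `l` tends to 0, the digit sum costs `l^{-1}` and the weights cost `l^{-e}`. The latter
follows from `exp (-y) = O(y^{-e})`; the condition `e > 1/r` makes the series of `(j + 1)^{-re}`
converge. -/
theorem exists_sum_digitWeight_rpow_le {u : ℕ → ℝ} (hu_pos : ∀ j, 0 < u j) (hu_anti : Antitone u)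
    {r : ℝ} (hr : 0 < r) (hu : 0 < Filter.liminf
      (fun j : ℕ => ((Real.log (u j)⁻¹ / ((j : ℝ) + 1) ^ r : ℝ) : EReal)) Filter.atTop)
    {e : ℝ} (he : 1 / r < e) :
    ∃ K : ℝ, 0 < K ∧ ∀ (s d M : ℕ) (l : ℝ), 0 < l → l ≤ 1 →
      ∑ t : Fin (s * d), ∑ i : Fin M, digitWeight b d u t i ^ l ≤ K * l ^ (-(1 + e)) := by
  obtain ⟨c, A, hc, hA, hdec⟩ := exists_decay hu_pos hu_anti hr hu
  have he0 : 0 < e := (by positivity : 0 < 1 / r).trans he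
  have hre : 1 < r * e := by rwa [div_lt_iff₀' hr] at he
  have hcb : 0 < walshConst b * (minConst b)⁻¹ := mul_pos walshConst_pos (inv_pos.2 minConst_pos)
  have hlog : 0 < Real.log b := Real.log_pos (by exact_mod_cast hbp.out.one_lt)
  set A' := max 1 (walshConst b * (minConst b)⁻¹ * A) with hA'
  have hA'1 : 1 ≤ A' := le_max_left _ _
  have hsum : Summable fun j : ℕ => ((j : ℝ) + 1) ^ (-(r * e)) := by
    have := (summable_nat_add_iff 1).2 (Real.summable_nat_rpow.2 (by linarith : -(r * e) < -1))
    simpa using this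
  set S := ∑' j : ℕ, ((j : ℝ) + 1) ^ (-(r * e)) with hS
  have hS0 : 0 < S := by
    refine hsum.tsum_pos (fun j => by positivity) 0 (by positivity)
  refine ⟨A' * (e ^ e * c ^ (-e)) * S * (Real.log b)⁻¹, by positivity, fun s d M l hl hl1 => ?_⟩
  rw [sum_fin_mul_digitWeight hu_pos, ← Finset.sum_mul]
  have h1 : ∀ j : ℕ, (walshConst b * (minConst b)⁻¹ * u j) ^ l ≤
      A' * (e ^ e * c ^ (-e)) * l ^ (-e) * ((j : ℝ) + 1) ^ (-(r * e)) := by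
    intro j
    have hj : (0 : ℝ) < ((j : ℝ) + 1) ^ r := by positivity
    calc (walshConst b * (minConst b)⁻¹ * u j) ^ l
        ≤ (A' * Real.exp (-(c * ((j : ℝ) + 1) ^ r))) ^ l := by
          refine Real.rpow_le_rpow (mul_pos hcb (hu_pos j)).le ?_ hl.le
          calc _ ≤ walshConst b * (minConst b)⁻¹ * (A * Real.exp (-(c * ((j : ℝ) + 1) ^ r))) :=
                mul_le_mul_of_nonneg_left (hdec j) hcb.le
            _ = walshConst b * (minConst b)⁻¹ * A * Real.exp (-(c * ((j : ℝ) + 1) ^ r)) := by ring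
            _ ≤ _ := mul_le_mul_of_nonneg_right (le_max_right _ _) (Real.exp_pos _).le
      _ = A' ^ l * Real.exp (-(l * c * ((j : ℝ) + 1) ^ r)) := by
          rw [Real.mul_rpow (by linarith) (Real.exp_pos _).le, ← Real.exp_mul]
          congr 2; ring
      _ ≤ A' * (e ^ e * (l * c * ((j : ℝ) + 1) ^ r) ^ (-e)) := by
          refine mul_le_mul ?_ (exp_neg_le (by positivity) he0) (Real.exp_pos _).le (by linarith)
          calc A' ^ l ≤ A' ^ (1 : ℝ) := Real.rpow_le_rpow_of_exponent_le hA'1 hl1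
            _ = A' := Real.rpow_one _
      _ = _ := by
          rw [Real.mul_rpow (by positivity) hj.le, Real.mul_rpow hl.le hc.le,
            ← Real.rpow_mul (by positivity)]
          rw [mul_neg]; ring
  have h2 : ∑ j : Fin s, (walshConst b * (minConst b)⁻¹ * u j) ^ l ≤
      A' * (e ^ e * c ^ (-e)) * l ^ (-e) * S := by
    rw [← Finset.sum_range fun j => (walshConst b * (minConst b)⁻¹ * u j) ^ l]
    refine (Finset.sum_le_sum fun j _ => h1 j).trans ?_
    rw [← Finset.mul_sum]
    refine mul_le_mul_of_nonneg_left ?_ (by positivity)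
    exact hsum.sum_le_tsum _ fun j _ => by positivity
  have h3 := sum_geometric_le (b := b) hl (M * d)
  refine (mul_le_mul h2 h3 (Finset.sum_nonneg fun n _ => by positivity) (by positivity)).trans
    (le_of_eq ?_)
  rw [neg_add, Real.rpow_add hl, Real.rpow_neg_one, mul_inv]
  ring

end InterlacedLattice

namespace InterlacedLattice

variable {b : ℕ} [hbp : Fact b.Prime]

/-! ### The convergence rates -/

theorem exists_rpow_le_add {a : ℝ} (ha : 0 < a) {c : ℝ} (hc : 0 < c) {β α : ℝ} (hβ : 0 < β)
    (hα : β < α) :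
    ∃ E : ℝ, ∀ m : ℕ, 0 < m → c * (m : ℝ) ^ β ≤ a * (m : ℝ) ^ α + E := by
  -- `X` is where the two powers balance: `c * X ^ β = a * X ^ α`.
  set X := (c / a) ^ (1 / (α - β)) with hX
  have hX0 : 0 < X := by positivity
  have hαβ : 0 < α - β := sub_pos.2 hα
  refine ⟨c * X ^ β, fun m hm => ?_⟩
  have hm' : (0 : ℝ) < m := by exact_mod_cast hm
  rcases le_total X m with h | h
  · have h1 : c / a ≤ (m : ℝ) ^ (α - β) := by
      calc c / a = X ^ (α - β) := by
            rw [hX, ← Real.rpow_mul (by positivity), one_div_mul_cancel hαβ.ne', Real.rpow_one]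
        _ ≤ _ := Real.rpow_le_rpow hX0.le h hαβ.le
    have h2 : (m : ℝ) ^ α = (m : ℝ) ^ (α - β) * (m : ℝ) ^ β := by
      rw [← Real.rpow_add hm', sub_add_cancel]
    rw [div_le_iff₀ ha] at h1
    have h3 : 0 < (m : ℝ) ^ β := by positivity
    have h4 : 0 < c * X ^ β := by positivity
    rw [h2]
    nlinarith
  · have h1 : (m : ℝ) ^ β ≤ X ^ β := Real.rpow_le_rpow hm'.le h hβ.le
    have h2 : 0 < a * (m : ℝ) ^ α := by positivity
    nlinarith

theorem merit_nonneg {m d τ : ℕ} (u : ℕ → ℝ) {p : (ZMod b)[X]} (hp : p ≠ 0)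
    (hm : p.natDegree = m) (q : Fin τ → (ZMod b)[X]) : 0 ≤ merit b m d u q p := by
  rw [merit_eq_dualSum u hp hm]
  linarith [one_le_dualSum (m := m) (fun t i => (digitWeight_pos (b := b) d u t i).le) p q]

/-- With `l = m^{-σ}` the averaging bound reads `merit^l ≤ exp (O(m^θ) - m log b)` with `θ < 1`.
Raising it to the power `m^σ` makes `-m^{1+σ} log b` the main term, and `1 + σ > κ`. -/
theorem exists_merit_le {u : ℕ → ℝ} (hu_pos : ∀ j, 0 < u j) (hu_anti : Antitone u)
    {r : ℝ} (hr : 0 < r) (hu : 0 < Filter.liminf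
      (fun j : ℕ => ((Real.log (u j)⁻¹ / ((j : ℝ) + 1) ^ r : ℝ) : EReal)) Filter.atTop)
    {κ : ℝ} (hκ1 : 1 ≤ κ) (hκ : κ < 1 + r / (r + 1)) :
    ∃ E : ℝ, 0 < E ∧ ∀ m s d : ℕ, 0 < m → ∀ p : (ZMod b)[X], Irreducible p → p.natDegree = m →
      ∀ q : Fin (s * d) → (ZMod b)[X], IsCBC b m s d u p q →
        merit b m d u q p ≤ E * (b : ℝ) ^ (-(2 * (m : ℝ) ^ κ)) := by
  obtain ⟨σ, hσ1, hσ2⟩ := exists_between (show κ - 1 < r / (r + 1) by linarith)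
  have hσ0 : 0 < σ := by linarith
  -- The inequality `σ < r/(r+1)` says exactly that `1/r < 1/σ - 1`; any `e` in between gives `θ <
  -- 1`.
  obtain ⟨e, he1, he2⟩ := exists_between (show 1 / r < 1 / σ - 1 by
    have : 1 / (r / (r + 1)) < 1 / σ := one_div_lt_one_div_of_lt hσ0 hσ2
    have e1 : 1 / (r / (r + 1)) = 1 + 1 / r := by field_simp
    linarith)
  have he0 : 0 < e := (by positivity : 0 < 1 / r).trans he1
  set θ := σ * (1 + e) with hθ
  have hθ1 : θ < 1 := by
    have : 1 + e < 1 / σ := by linarith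
    rwa [lt_div_iff₀' hσ0] at this
  have hθ0 : 0 < θ := by positivity
  obtain ⟨K, hK, hsum⟩ := exists_sum_digitWeight_rpow_le (b := b) hu_pos hu_anti hr hu he1
  have hb2 : (2 : ℝ) ≤ b := by exact_mod_cast hbp.out.two_le
  have hb : (0 : ℝ) < b := cast_pos
  set L := Real.log b with hL
  have hL0 : 0 < L := Real.log_pos (by linarith)
  have hlog2 : 0 < Real.log 2 := Real.log_pos one_lt_two
  -- The main term is shared in thirds between the factor 2 from `b^m - 1 ≥ b^m / 2`, the product
  -- over the weights, and the target exponent `2 m^κ`.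
  obtain ⟨E1, hE1⟩ := exists_rpow_le_add (show 0 < L / 3 by positivity) hlog2 hσ0
    (show σ < 1 + σ by linarith)
  obtain ⟨E2, hE2⟩ := exists_rpow_le_add (show 0 < L / 3 by positivity)
    (show 0 < (b - 1) * K from mul_pos (by linarith) hK) (show 0 < θ + σ by positivity)
    (show θ + σ < 1 + σ by linarith)
  obtain ⟨E3, hE3⟩ := exists_rpow_le_add (show 0 < L / 3 by positivity)
    (show 0 < 2 * L by positivity) (show 0 < κ by linarith) (show κ < 1 + σ by linarith)
  refine ⟨Real.exp (E1 + E2 + E3), Real.exp_pos _, fun m s d hm p hp hpm q hq => ?_⟩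
  have hm1 : (1 : ℝ) ≤ m := by exact_mod_cast hm
  have hm0 : (0 : ℝ) < m := by linarith
  set l := (m : ℝ) ^ (-σ) with hl
  have hl0 : 0 < l := by positivity
  have hl1 : l ≤ 1 := Real.rpow_le_one_of_one_le_of_nonpos hm1 (by linarith)
  have hB := merit_nonneg (d := d) u hp.ne_zero hpm q
  have h1 := hq.merit_rpow_le hp hpm hl0 hl1
  have h2 : ∏ t : Fin (s * d), ∏ i : Fin m, (1 + ((b : ℝ) - 1) * digitWeight b d u t i ^ l) ≤
      Real.exp ((b - 1) * K * (m : ℝ) ^ θ) := by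
    refine (prod_one_add_le_exp fun t i => mul_nonneg (by linarith)
      (Real.rpow_nonneg (digitWeight_pos d u t i).le _)).trans ?_
    rw [Real.exp_le_exp]
    simp_rw [← Finset.mul_sum]
    rw [mul_assoc]
    refine mul_le_mul_of_nonneg_left ((hsum s d m l hl0 hl1).trans (le_of_eq ?_)) (by linarith)
    rw [hl, ← Real.rpow_mul hm0.le, hθ]
    congr 2; ring
  have hbm : (b : ℝ) ^ m = Real.exp (m * L) := by
    rw [hL, mul_comm, Real.exp_mul, Real.exp_log hb, Real.rpow_natCast]
  have h3 : (b : ℝ) ^ m / 2 ≤ (b : ℝ) ^ m - 1 := by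
    have : (b : ℝ) ^ 1 ≤ (b : ℝ) ^ m := pow_le_pow_right₀ (by linarith) hm
    linarith
  have h4 : merit b m d u q p ^ l ≤
      Real.exp (Real.log 2 + (b - 1) * K * (m : ℝ) ^ θ - m * L) := by
    have h5 := (mul_le_mul_of_nonneg_right h3 (Real.rpow_nonneg hB l)).trans (h1.trans h2)
    rw [Real.exp_sub, Real.exp_add, Real.exp_log two_pos, ← hbm, le_div_iff₀ (by positivity)]
    linarith
  have h6 : merit b m d u q p = (merit b m d u q p ^ l) ^ ((m : ℝ) ^ σ) := by
    rw [← Real.rpow_mul hB, hl, ← Real.rpow_add hm0, neg_add_cancel, Real.rpow_zero, Real.rpow_one]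
  rw [h6]
  refine (Real.rpow_le_rpow (Real.rpow_nonneg hB l) h4 (by positivity)).trans ?_
  rw [← Real.exp_mul, Real.rpow_def_of_pos hb, ← Real.exp_add, Real.exp_le_exp]
  have e1 : (m : ℝ) ^ (θ + σ) = (m : ℝ) ^ θ * (m : ℝ) ^ σ := Real.rpow_add hm0 _ _
  have e2 : (m : ℝ) ^ (1 + σ) = m * (m : ℝ) ^ σ := by rw [Real.rpow_add hm0, Real.rpow_one]
  have f1 := hE1 m hm
  have f2 := hE2 m hm
  have f3 := hE3 m hm
  rw [e2] at f1 f2 f3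
  rw [e1] at f2
  rw [← hL]
  linear_combination f1 + f2 + f3

/-- For `D ≥ 1` the logarithm is at most `m`, and so is its replacement by 0. -/
theorem le_rate {m : ℕ} (hm : 0 < m) {lam D : ℝ} (hlam : 0 < lam) (hD : 1 ≤ D) :
    (b : ℝ) ^ (-((m : ℝ) ^ (1 / lam))) ≤ rate b m lam D := by
  have hb1 : (1 : ℝ) < b := by exact_mod_cast hbp.out.one_lt
  unfold rate
  refine Real.rpow_le_rpow_of_exponent_le hb1.le (neg_le_neg ?_)
  refine Real.rpow_le_rpow (le_max_left _ _) (max_le (by positivity) ?_) (by positivity)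
  have h1 : 0 < (b : ℝ) ^ m - 1 := sub_pos.2 (one_lt_pow₀ hb1 hm.ne')
  rw [Real.logb_le_iff_le_rpow hb1 (by positivity), Real.rpow_natCast]
  refine (div_le_self h1.le hD).trans (by linarith)

theorem digitWeight_le {d m : ℕ} {u : ℕ → ℝ} (hu : ∀ j, 0 < u j) (hu_anti : Antitone u) (t : ℕ)
    {i : ℕ} (hi : m ≤ i) :
    digitWeight b d u t i ≤ walshConst b * (minConst b)⁻¹ * u 0 * ((b : ℝ) ^ (d * m))⁻¹ := by
  have hb1 : (1 : ℝ) ≤ b := by exact_mod_cast hbp.out.one_le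
  have hb : (0 : ℝ) < b := cast_pos
  have hc : 0 < walshConst b * (minConst b)⁻¹ := mul_pos walshConst_pos (inv_pos.2 minConst_pos)
  rw [digitWeight_eq hu, mul_comm]
  refine mul_le_mul (mul_le_mul_of_nonneg_left (hu_anti (Nat.zero_le _)) hc.le) ?_ (by positivity)
    (mul_pos hc (hu 0)).le
  refine inv_anti₀ (by positivity) (pow_le_pow_right₀ hb1 ?_)
  have := Nat.mul_le_mul_left d hi
  omega

theorem exists_worstCaseError_le {u : ℕ → ℝ} (hu_pos : ∀ j, 0 < u j) (hu_anti : Antitone u)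
    {r : ℝ} (hr : 0 < r) (hu : 0 < Filter.liminf
      (fun j : ℕ => ((Real.log (u j)⁻¹ / ((j : ℝ) + 1) ^ r : ℝ) : EReal)) Filter.atTop) :
    ∃ c X : ℝ, 0 < c ∧ 0 < X ∧ ∀ m s d : ℕ, 0 < d → ∀ p : (ZMod b)[X], p ≠ 0 → p.natDegree = m →
      ∀ q : Fin (s * d) → (ZMod b)[X],
        worstCaseError u (b ^ m) (interlacedPoint b m s d q p) ≤
          ENNReal.ofReal (c * (merit b m d u q p + X * ((b : ℝ) ^ (d * m))⁻¹) ^ (1 / 2 : ℝ)) := by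
  classical
  -- Any exponent above `1/r` serves, since the sum is needed only for `l = 1` and `l = 1/2`.
  obtain ⟨S, hS, hsum⟩ := exists_sum_digitWeight_rpow_le (b := b) hu_pos hu_anti hr hu
    (show 1 / r < 1 / r + 1 by linarith)
  have hb1 : (1 : ℝ) ≤ b := by exact_mod_cast hbp.out.one_le
  have hb : (0 : ℝ) < b := cast_pos
  have hc : 0 < walshConst b * (minConst b)⁻¹ := mul_pos walshConst_pos (inv_pos.2 minConst_pos)
  set K := b * (walshConst b * (minConst b)⁻¹)⁻¹ with hK
  have hK0 : 0 < K := by positivity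
  set S₂ := S * (1 / 2 : ℝ) ^ (-(1 + (1 / r + 1))) with hS₂
  set X := walshConst b * (minConst b)⁻¹ * u 0 with hX
  have hX0 : 0 < X := mul_pos hc (hu_pos 0)
  have hw : ∀ d t i, 0 ≤ digitWeight b d u t i := fun d t i => (digitWeight_pos d u t i).le
  refine ⟨Real.exp S ^ (1 / 2 : ℝ) * Real.exp ((b - 1) * (K * S₂)), X, by positivity, hX0,
    fun m s d hd p hp hm q => ?_⟩
  have hB := merit_nonneg (d := d) u hp hm q
  refine iSup₂_le fun f hf => ENNReal.ofReal_le_ofReal ?_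
  -- The number `m₂` depends on `ε` and `f`, but the bounds below do not depend on `m₂`, so `ε` can
  -- be removed.
  refine le_of_forall_pos_le_add fun ε hε => ?_
  obtain ⟨m₂, h⟩ := abs_qmc_sub_integral_le hd hu_pos hp hm q hf.1.1 hf.2 hε
  refine h.trans ?_
  rw [add_comm]
  refine add_le_add ?_ le_rfl
  have e : (fun (t : Fin (s * d)) (i : Fin (m + m₂)) => coeffWeight b d u t i) =
      fun (t : Fin (s * d)) (i : Fin (m + m₂)) => K * digitWeight b d u t i := by
    funext t i
    rw [coeffWeight_eq hu_pos]
  rw [e]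
  have hY0 : 0 ≤ X * ((b : ℝ) ^ (d * m))⁻¹ := by positivity
  refine (sum_isDual_le (hw d) p q hY0 hK0.le
    (fun t _ i hi => digitWeight_le hu_pos hu_anti t hi)).trans ?_
  rw [← merit_eq_dualSum u hp hm]
  have h1 : ∏ t : Fin (s * d), ∏ i : Fin (m + m₂), (1 + digitWeight b d u t i) ≤ Real.exp S := by
    refine (prod_one_add_le_exp fun t i => hw d t i).trans (Real.exp_le_exp.2 ?_)
    have := hsum s d (m + m₂) 1 one_pos le_rfl
    simpa using this
  have h2 : ∏ t : Fin (s * d), ∏ i : Fin (m + m₂),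
      (1 + ((b : ℝ) - 1) * (K * digitWeight b d u t i ^ (1 / 2 : ℝ))) ≤
      Real.exp ((b - 1) * (K * S₂)) := by
    refine (prod_one_add_le_exp fun t i => mul_nonneg (by linarith) (mul_nonneg hK0.le
      (Real.rpow_nonneg (hw d t i) _))).trans (Real.exp_le_exp.2 ?_)
    simp_rw [← Finset.mul_sum]
    exact mul_le_mul_of_nonneg_left (mul_le_mul_of_nonneg_left
      (hsum s d (m + m₂) (1 / 2) (by norm_num) (by norm_num)) hK0.le) (by linarith)
  have hB2 : 0 ≤ merit b m d u q p + X * ((b : ℝ) ^ (d * m))⁻¹ := add_nonneg hB hY0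
  have h0 : 0 ≤ ∏ t : Fin (s * d), ∏ i : Fin (m + m₂), (1 + digitWeight b d u t i) :=
    Finset.prod_nonneg fun t _ => Finset.prod_nonneg fun i _ => by linarith [hw d t i]
  calc _ ≤ ((merit b m d u q p + X * ((b : ℝ) ^ (d * m))⁻¹) * Real.exp S) ^ (1 / 2 : ℝ) *
        Real.exp ((b - 1) * (K * S₂)) := by
        refine mul_le_mul ?_ h2 (Finset.prod_nonneg fun t _ => Finset.prod_nonneg fun i _ => ?_)
          (by positivity)
        · exact Real.rpow_le_rpow (mul_nonneg hB2 h0) (mul_le_mul_of_nonneg_left h1 hB2)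
            (by norm_num)
        · have : 0 ≤ ((b : ℝ) - 1) * (K * digitWeight b d u t i ^ (1 / 2 : ℝ)) :=
            mul_nonneg (by linarith) (mul_nonneg hK0.le (Real.rpow_nonneg (hw d t i) _))
          linarith
    _ = _ := by
        rw [Real.mul_rpow hB2 (Real.exp_pos _).le]; ring

end InterlacedLattice

end

/-! ### Choice of constants and proof of the theorem -/

open InterlacedLattice
theorem mainTheorem2 (b : ℕ) [Fact b.Prime] (u : ℕ → ℝ) (hu_pos : ∀ j, 0 < u j)
    (hu_anti : Antitone u) (r : ℝ) (hr : 0 < r)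
    (hu : 0 < Filter.liminf
      (fun j : ℕ => ((Real.log (u j)⁻¹ / ((j : ℝ) + 1) ^ r : ℝ) : EReal)) Filter.atTop)
    (lam : ℝ) (hlam : (r + 1) / (2 * r + 1) < lam) (hlam' : lam ≤ 1) :
    ∃ D E E' : ℝ, 0 < D ∧ 0 < E ∧ 0 < E' ∧
      ∀ m s d : ℕ, 0 < m → 0 < s → 0 < d →
      ∀ p : Polynomial (ZMod b), Irreducible p → p.natDegree = m →
      ∀ q : Fin (s * d) → Polynomial (ZMod b), IsCBC b m s d u p q →
        merit b m d u q p ≤ E * rate b m lam D ∧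
        ((m : ℝ) ^ (r / (r + 1)) ≤ d →
          worstCaseError u (b ^ m) (interlacedPoint b m s d q p) ≤
            ENNReal.ofReal (E' * rate b m lam (D + 1))) := by
  have hlam0 : 0 < lam := (by positivity : 0 < (r + 1) / (2 * r + 1)).trans hlam
  have hκ1 : 1 ≤ 1 / lam := by rwa [le_div_iff₀ hlam0, one_mul]
  have hκ : 1 / lam < 1 + r / (r + 1) := by
    have h1 : 1 / lam < 1 / ((r + 1) / (2 * r + 1)) :=
      one_div_lt_one_div_of_lt (by positivity) hlam
    have h2 : 1 / ((r + 1) / (2 * r + 1)) = 1 + r / (r + 1) := by field_simp; ring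
    linarith
  have hb1 : (1 : ℝ) < b := by exact_mod_cast (Fact.out : b.Prime).one_lt
  have hb : (0 : ℝ) < b := by linarith
  have hL : 0 < Real.log b := Real.log_pos hb1
  obtain ⟨E, hE, hmerit⟩ := exists_merit_le (b := b) hu_pos hu_anti hr hu hκ1 hκ
  obtain ⟨c, X, hc, hX, hwce⟩ := exists_worstCaseError_le (b := b) hu_pos hu_anti hr hu
  -- Since `1/lam < 1 + r/(r+1)`, the exponent `2 m^{1/lam}` is at most `m^{1 + r/(r+1)}` up to a
  -- constant; this serves to compare it with `d * m`.
  obtain ⟨G, hG⟩ := exists_rpow_le_add hL (show 0 < 2 * Real.log b by positivity)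
    (show 0 < 1 / lam by positivity) hκ
  -- `D = 1` suffices because both quantities are bounded by multiples of `b^{-m^{1/lam}}`, which
  -- lies below the rate.
  refine ⟨1, E, c * (E + X * Real.exp G) ^ (1 / 2 : ℝ), one_pos, hE, by positivity,
    fun m s d hm _ hd p hp hpm q hq => ?_⟩
  have hm0 : (0 : ℝ) < m := by exact_mod_cast hm
  have hB := hmerit m s d hm p hp hpm q hq
  have hr1 := le_rate (b := b) hm hlam0 le_rfl
  have hr2 := le_rate (b := b) hm hlam0 (show (1 : ℝ) ≤ 1 + 1 by norm_num)
  set μ := (m : ℝ) ^ (1 / lam) with hμ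
  have hμ0 : 0 < μ := by positivity
  refine ⟨?_, fun hdm => ?_⟩
  · refine hB.trans (mul_le_mul_of_nonneg_left (le_trans ?_ hr1) hE.le)
    exact Real.rpow_le_rpow_of_exponent_le hb1.le (by linarith)
  · refine (hwce m s d hd p hp.ne_zero hpm q).trans (ENNReal.ofReal_le_ofReal ?_)
    rw [mul_assoc]
    refine mul_le_mul_of_nonneg_left ?_ hc.le
    have h1 : ((b : ℝ) ^ (d * m))⁻¹ ≤ Real.exp G * (b : ℝ) ^ (-(2 * μ)) := by
      rw [← Real.rpow_natCast, ← Real.rpow_neg hb.le, Real.rpow_def_of_pos hb,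
        Real.rpow_def_of_pos hb, ← Real.exp_add, Real.exp_le_exp]
      have h2 := hG m hm
      rw [Real.rpow_add hm0, Real.rpow_one] at h2
      have h3 := mul_le_mul_of_nonneg_left (mul_le_mul_of_nonneg_left hdm hm0.le) hL.le
      push_cast
      linear_combination h2 + h3
    have h4 : merit b m d u q p + X * ((b : ℝ) ^ (d * m))⁻¹ ≤
        (E + X * Real.exp G) * (b : ℝ) ^ (-(2 * μ)) := by
      linear_combination hB + X * h1
    have hB0 := merit_nonneg (d := d) u hp.ne_zero hpm q
    refine (Real.rpow_le_rpow (by positivity) h4 (by norm_num)).trans ?_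
    rw [Real.mul_rpow (by positivity) (by positivity), ← Real.rpow_mul hb.le]
    refine mul_le_mul_of_nonneg_left ?_ (by positivity)
    -- The square root halves the exponent `2 μ`, leaving exactly the one in `le_rate`.
    rw [show -(2 * μ) * (1 / 2) = -μ by ring]
    exact hr2
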